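/- An ABA framework consists of a set $\mathcal L$ of sentences, a set $\mathcal R$ of rules $\varphi_0\leftarrow\varphi_1,\dots,\varphi_m$ ($m\ge 0$, $\varphi_i\in\mathcal L$), a non-empty set $\mathcal A\subseteq\mathcal L$ of assumptions, and a total map $\alpha\mapsto\overline\alpha$ from $\mathcal A$ to $\mathcal L$ (the contrary). A deduction for $\varphi$ supported by $A'\subseteq\mathcal A$ and $R\subseteq\mathcal R$ is a finite tree with root $\varphi$ whose leaves are labelled by $\top$ or by assumptions, $A'$ being the set of all these assumptions, and in which the children of each non-leaf $\psi$ are labelled by the elements of the body of a $\psi$-headed rule (by $\top$ if that body is empty), $R$ being the set of all rules so used. For $A,B\subseteq\mathcal A$: $A$ attacks $B$ if for some $\beta\in B$ there is a deduction for $\overline\beta$ supported by a subset of $A$; the closure $Cl(A)$ is the set of all $\alpha\in\mathcal A$ that have a deduction supported by a subset of $A$; $A$ is closed if $A=Cl(A)$, and conflict-free if $A$ does not attack $A$. The set $A\subseteq\mathcal A$ is set-stable if it is closed and conflict-free and attacks $Cl(\{\alpha\})$ for every $\alpha\in\mathcal A\setminus A$. The framework is bipolar if every rule has the form $\varphi\leftarrow\alpha$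 with $\alpha\in\mathcal A$ and either $\varphi\in\mathcal A$ or $\varphi=\overline\beta$ for some $\beta\in\mathcal A$. **Proposition.** The following decision problem is in $\mathsf P$: given a finite bipolar ABA framework $(\mathcal L,\mathcal R,\mathcal A,\overline{\phantom{a}})$ and a set $A\subseteq\mathcal A$, is $A$ set-stable? Here the sentences are finite binary words, and the input is a word over a finite alphabet that explicitly lists $\mathcal L$, the assumptions with their contraries, the rules, and the elements of $A$. That is, the language of all encodings of pairs of a finite bipolar ABA framework and a set-stable set of its assumptions is decided by a deterministic Turing machine in a number of steps polynomial in the length of the input. -/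

import Mathlib

namespace ABA

universe u

/-- A rule `head ← body`; a rule with empty body is a rule `head ← ⊤`. -/
structure Rule (S : Type u) where
  head : S
  body : List S

/-- An assumption-based argumentation framework whose sentences are elements of `S`. -/
structure Framework (S : Type u) where
  language : Set S
  rules : Set (Rule S)
  assumptions : Set S
  contrary : assumptions → S
  head_mem : ∀ r ∈ rules, r.head ∈ language
  body_mem : ∀ r ∈ rules, ∀ s ∈ r.body, s ∈ language
  assumptions_subset : assumptions ⊆ language
  assumptions_nonempty : assumptions.Nonempty
  contrary_mem : ∀ a : assumptions, contrary a ∈ language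

namespace Framework

variable {S : Type u}

/-- `F.Deduction A R s`: there is a finite tree with root labelled by `s`, in which every leaf is
labelled by `⊤` or by an assumption, every other node is obtained from its children by a rule,
`A` is the set of all assumptions at the leaves, and `R` is the set of all rules used.
The constructors are the one-node tree and the tree whose root is obtained by the rule `r`, with
one subtree for each entry of the body (and the single leaf `⊤` below the root if the body is
empty). -/
inductive Deduction (F : Framework S) : Set S → Set (Rule S) → S → Prop
  | leaf (a : S) (ha : a ∈ F.assumptions) : Deduction F {a} ∅ a
  | node (r : Rule S) (hr : r ∈ F.rules)
      (A : Fin r.body.length → Set S) (R : Fin r.body.length → Set (Rule S))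
      (h : ∀ i, Deduction F (A i) (R i) (r.body.get i)) :
      Deduction F (⋃ i, A i) ({r} ∪ ⋃ i, R i) r.head

/-- `s` has a deduction supported by a subset of `A`. -/
def Derives (F : Framework S) (A : Set S) (s : S) : Prop :=
  ∃ A' R, A' ⊆ A ∧ R ⊆ F.rules ∧ F.Deduction A' R s

/-- `A` attacks `B`: the contrary of some assumption in `B` is derivable from `A`. -/
def Attacks (F : Framework S) (A B : Set S) : Prop :=
  ∃ b : F.assumptions, (b : S) ∈ B ∧ F.Derives A (F.contrary b)

/-- The closure of a set of assumptions. -/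
def cl (F : Framework S) (A : Set S) : Set S :=
  {a | a ∈ F.assumptions ∧ F.Derives A a}

def IsClosed (F : Framework S) (A : Set S) : Prop :=
  A = F.cl A

def ConflictFree (F : Framework S) (A : Set S) : Prop :=
  ¬ F.Attacks A A

/-- `A` is a set-stable extension of `F`. -/
def SetStable (F : Framework S) (A : Set S) : Prop :=
  A ⊆ F.assumptions ∧ F.IsClosed A ∧ F.ConflictFree A ∧
    ∀ a ∈ F.assumptions \ A, F.Attacks A (F.cl {a})

/-- Every rule has the form `s ← a` with `a` an assumption and `s` an assumption or the contrary
of an assumption. -/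
def Bipolar (F : Framework S) : Prop :=
  ∀ r ∈ F.rules, (∃ a ∈ F.assumptions, r.body = [a]) ∧
    (r.head ∈ F.assumptions ∨ ∃ b : F.assumptions, r.head = F.contrary b)

end Framework

/-- The input alphabet: two bits, and six marks that start a field. -/
inductive Symbol
  | bit (b : Bool)
  | sentence
  | assumption
  | contrary
  | head
  | body
  | member
  deriving DecidableEq, Fintype

/-- A mark followed by the bits of a sentence. -/
def field (t : Symbol) (s : List Bool) : List Symbol :=
  t :: s.map Symbol.bit

def encodeContrary (p : List Bool × List Bool) : List Symbol :=
  field Symbol.assumption p.1 ++ field Symbol.contrary p.2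

def encodeRule (r : Rule (List Bool)) : List Symbol :=
  field Symbol.head r.head ++ r.body.flatMap (field Symbol.body)

/-- The word `w` encodes the finite framework `F`, whose sentences are binary words, together with
the set `A`: it lists the language, the assumptions with their contraries, the rules, and the
members of `A`, each list in any order. -/
def Encodes (w : List Symbol) (F : Framework (List Bool)) (A : Set (List Bool)) : Prop :=
  ∃ (ss : List (List Bool)) (ps : List (List Bool × List Bool)) (rs : List (Rule (List Bool)))
    (ms : List (List Bool)),
    (∀ s, s ∈ ss ↔ s ∈ F.language) ∧
    (∀ p, p ∈ ps ↔ ∃ a : F.assumptions, p = (a.1, F.contrary a)) ∧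
    (∀ r, r ∈ rs ↔ r ∈ F.rules) ∧
    (∀ s, s ∈ ms ↔ s ∈ A) ∧
    w = ss.flatMap (field Symbol.sentence) ++ ps.flatMap encodeContrary ++
      rs.flatMap encodeRule ++ ms.flatMap (field Symbol.member)

/-- The verification problem for the set-stable semantics of bipolar frameworks, as a language:
the encodings of the pairs of a finite bipolar framework and one of its set-stable extensions. -/
def setStableVER : Language Symbol :=
  {w | ∃ (F : Framework (List Bool)) (A : Set (List Bool)),
    A ⊆ F.assumptions ∧ F.Bipolar ∧ Encodes w F A ∧ F.SetStable A}

/-- The class P: a language over a finite alphabet is in P if its characteristic function is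
computed on all words by a Turing machine (with several stacks, all of them over finite alphabets)
in a number of steps that is bounded by a polynomial in the length of the input. -/
def InP {Γ : Type} [Fintype Γ] (L : Language Γ) : Prop :=
  ∃ f : List Γ → Bool, (∀ w, f w = true ↔ w ∈ L) ∧
    ∃ M : Turing.TM2ComputableInPolyTime (id : List Γ → List Γ) Computability.encodeBool f,
      ∀ k, Finite (M.tm.Γ k)

end ABA

/-! In a bipolar framework every rule body is a single assumption, so a deduction is a path in the
graph of rules (`derives_iff`). Along such a path every vertex except the last is a rule body, hence
an assumption. If `A` is closed under single rules, only the last step of a path can therefore leave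
`A`, and `A` derives exactly its elements and the heads of rules with body in `A`
(`derives_iff_forces`). Closedness and conflict-freeness thus become checks of single rules. The
condition on an assumption outside `A` becomes reachability: some path leads from it to an
assumption whose contrary is forced by `A` (`setStable_iff`). The assumptions with such a path form
the least fixed point of a monotone operator. It is reached after as many rounds as there are
assumptions (`iterate_stabilizes`), and their number is at most the length of the input.

One round of this search, the syntactic correctness of the input and the final test are all
first-order conditions on the suffixes of the input word, with one unary predicate `Q` for the
intermediate result of the search. The machine-theoretic part is therefore a general theorem,
`inP_of_fm`: a language is in P if it is defined by a formula evaluated after `|w|` iterations of a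
definable predicate. A formula is compiled to a structured program whose quantifiers are loops over
suffixes (`exec_comp`), `Q` being stored as one bit beside each letter, and structured programs are
compiled to stack machines (`Exec.stepsTo`). It remains to match words with frameworks
(`wellFormed_iff`, `exists_encodes`, `Lists.stable_iff`). -/

namespace ABA

/-! ### Structured stack programs and their compilation to Turing machines -/

open Function Turing

/-- Structured programs acting on stacks indexed by `V` with entries in `α`.  `mv a f bs` pops an
entry `c` of `a` (if there is one) and pushes `f c` on the stacks in `bs`; `ite` and `loop` test
the top of a stack. -/
inductive Prog (V α : Type) : Type
  | skip
  | push (a : V) (c : α)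
  | mv (a : V) (f : α → α) (bs : List V)
  | seq (p q : Prog V α)
  | ite (a : V) (t : Option α → Bool) (p q : Prog V α)
  | loop (a : V) (t : Option α → Bool) (p : Prog V α)

namespace Prog

variable {V α β : Type}

/-- The labels of the machine code of a program. -/
def Lab : Prog V α → Type
  | skip => Unit
  | push _ _ => Unit
  | mv _ _ _ => Unit
  | seq p q => Lab p ⊕ Lab q
  | ite _ _ p q => Option (Lab p ⊕ Lab q)
  | loop _ _ p => Option (Lab p)

lemma finite_lab : (p : Prog V α) → Finite (Lab p)
  | skip => inferInstanceAs (Finite Unit)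
  | push _ _ => inferInstanceAs (Finite Unit)
  | mv _ _ _ => inferInstanceAs (Finite Unit)
  | seq p q =>
    have := finite_lab p
    have := finite_lab q
    inferInstanceAs (Finite (Lab p ⊕ Lab q))
  | ite _ _ p q =>
    have := finite_lab p
    have := finite_lab q
    inferInstanceAs (Finite (Option (Lab p ⊕ Lab q)))
  | loop _ _ p =>
    have := finite_lab p
    inferInstanceAs (Finite (Option (Lab p)))

/-- The entry label of a program. -/
def entry : (p : Prog V α) → Lab p
  | skip => ()
  | push _ _ => ()
  | mv _ _ _ => ()
  | seq p _ => Sum.inl (entry p)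
  | ite _ _ _ _ => none
  | loop _ _ _ => none

variable [DecidableEq V]

/-- Push `c` on all stacks in a list. -/
def pushAll (c : α) : List V → (V → List α) → V → List α
  | [], S => S
  | b :: bs, S => pushAll c bs (update S b (c :: S b))

/-- The effect of `mv a f bs`. -/
def mvState (a : V) (f : α → α) (bs : List V) (S : V → List α) : V → List α :=
  match S a with
  | [] => S
  | c :: l => pushAll (f c) bs (update S a l)

/-- `Exec p S T S'`: started in `S`, the program `p` stops in `S'` after at most `T` steps. -/
inductive Exec : Prog V α → (V → List α) → ℕ → (V → List α) → Prop
  | skip (S) : Exec skip S 1 S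
  | push (a c S) : Exec (push a c) S 1 (update S a (c :: S a))
  | mv (a f bs S) : Exec (mv a f bs) S 1 (mvState a f bs S)
  | seq {p q S S' S'' t t'} : Exec p S t S' → Exec q S' t' S'' → Exec (seq p q) S (t + t') S''
  | ite_true {a t p q S S' n} : t (S a).head? = true → Exec p S n S' →
      Exec (ite a t p q) S (n + 1) S'
  | ite_false {a t p q S S' n} : t (S a).head? = false → Exec q S n S' →
      Exec (ite a t p q) S (n + 1) S'
  | loop_true {a t p S S' S'' n n'} : t (S a).head? = true → Exec p S n S' →
      Exec (loop a t p) S' n' S'' → Exec (loop a t p) S (n + n' + 1) S''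
  | loop_false {a t p S} : t (S a).head? = false → Exec (loop a t p) S 1 S
  | mono {p S S' n n'} : n ≤ n' → Exec p S n S' → Exec p S n' S'

/-- The alphabets of the stacks of the machine: an input stack, an output stack, and the stacks
of the program. -/
abbrev Alph (V α β : Type) : Option (Option V) → Type
  | none => β
  | some none => Bool
  | some (some _) => α

/-- Push the stored entry, transformed by `f`, on all stacks in a list, then jump to `next`. -/
def pushStmt {L : Type} [Inhabited α] (f : α → α) (next : L) :
    List V → TM2.Stmt (Alph V α β) L (Option α)
  | [] => .goto fun _ => next
  | b :: bs => .push (some (some b)) (fun s : Option α => f (s.getD default))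
      (pushStmt f next bs)

/-- The machine code of a program, with labels embedded by `emb` and exit label `next`. -/
def code {L : Type} [Inhabited α] : (p : Prog V α) → (Lab p → L) → L → Lab p →
    TM2.Stmt (Alph V α β) L (Option α)
  | skip, _, next => fun _ => .goto fun _ => next
  | push a c, _, next => fun _ => .push (some (some a)) (fun _ => c) (.goto fun _ => next)
  | mv a f bs, _, next => fun _ => .pop (some (some a)) (fun _ o => o)
      (.branch Option.isSome (pushStmt f next bs) (.goto fun _ => next))
  | seq p q, emb, next => fun l => match l with
    | .inl l => code p (fun l => emb (.inl l)) (emb (.inr (entry q))) l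
    | .inr l => code q (fun l => emb (.inr l)) next l
  | ite a t p q, emb, next => fun l => match l with
    | none => .peek (some (some a)) (fun _ o => o)
        (.branch t (.goto fun _ => emb (some (.inl (entry p))))
          (.goto fun _ => emb (some (.inr (entry q)))))
    | some (.inl l) => code p (fun l => emb (some (.inl l))) next l
    | some (.inr l) => code q (fun l => emb (some (.inr l))) next l
  | loop a t p, emb, next => fun l => match l with
    | none => .peek (some (some a)) (fun _ o => o)
        (.branch t (.goto fun _ => emb (some (entry p))) (.goto fun _ => next))
    | some l => code p (fun l => emb (some l)) (emb none) l

/-- The stacks of the machine: input `x`, output `y`, and the stacks of the program. -/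
def allStacks (x : List β) (y : List Bool) (S : V → List α) : ∀ k, List (Alph V α β k)
  | none => x
  | some none => y
  | some (some v) => S v

lemma update_stacks (x : List β) (y : List Bool) (S : V → List α) (a : V) (l : List α) :
    update (allStacks x y S) (some (some a)) l = allStacks x y (update S a l) := by
  funext k
  rcases k with _ | _ | v
  · rfl
  · rfl
  · by_cases h : v = a
    · subst h; simp [allStacks]
    · simp [allStacks, update_of_ne, h]

lemma update_stacks_input (x x' : List β) (y : List Bool) (S : V → List α) :
    update (allStacks x y S) none x' = allStacks x' y S := by
  funext k
  rcases k with _ | _ | v <;> simp [allStacks]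

lemma update_stacks_output (x : List β) (y y' : List Bool) (S : V → List α) :
    update (allStacks x y S) (some none) y' = allStacks x y' S := by
  funext k
  rcases k with _ | _ | v <;> simp [allStacks]

/-- `c` becomes `c'` after exactly `n` steps. -/
def StepsTo {K L σ : Type} {Γ : K → Type} [DecidableEq K] (M : L → TM2.Stmt Γ L σ) (n : ℕ)
    (c c' : TM2.Cfg Γ L σ) : Prop :=
  (flip bind (TM2.step M))^[n] (some c) = some c'

section

variable {K L σ : Type} {Γ : K → Type} [DecidableEq K] {M : L → TM2.Stmt Γ L σ}

lemma StepsTo.trans {n n' : ℕ} {c c' c'' : TM2.Cfg Γ L σ} (h : StepsTo M n c c')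
    (h' : StepsTo M n' c' c'') : StepsTo M (n + n') c c'' := by
  unfold StepsTo at *
  rw [Nat.add_comm, iterate_add_apply, h, h']

lemma stepsTo_one (l : L) (v : σ) (S : ∀ k, List (Γ k)) :
    StepsTo M 1 ⟨some l, v, S⟩ (TM2.stepAux (M l) v S) := rfl

end

lemma stepAux_pushStmt {L : Type} [Inhabited α] (f : α → α) (next : L) (c : α) (x : List β)
    (y : List Bool) (bs : List V) (S : V → List α) :
    TM2.stepAux (pushStmt f next bs) (some c) (allStacks x y S) =
      ⟨some next, some c, allStacks x y (pushAll (f c) bs S)⟩ := by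
  induction bs generalizing S with
  | nil => rfl
  | cons b bs ih =>
    simp only [pushStmt, TM2.stepAux, Option.getD_some]
    rw [update_stacks, ih]; rfl

/-- Induction on the execution. The label embedding and the exit label are arbitrary, so that the
claim applies to a program placed inside the code of a larger one. The register content `v` is
arbitrary too, because an instruction that reads the register has loaded it first. -/
theorem Exec.stepsTo {L : Type} [Inhabited α] {M : L → TM2.Stmt (Alph V α β) L (Option α)}
    (x : List β) (y : List Bool) {p : Prog V α} {S S' : V → List α} {T : ℕ}
    (h : Exec p S T S') (emb : Lab p → L) (next : L)
    (hM : ∀ l, M (emb l) = code p emb next l) (v : Option α) :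
    ∃ n ≤ T, ∃ v', StepsTo M n ⟨some (emb (entry p)), v, allStacks x y S⟩
      ⟨some next, v', allStacks x y S'⟩ := by
  induction h generalizing next v with
  | skip S =>
    refine ⟨1, le_rfl, v, ?_⟩
    have := stepsTo_one (M := M) (emb ()) v (allStacks x y S)
    rwa [hM ()] at this
  | push a c S =>
    refine ⟨1, le_rfl, v, ?_⟩
    have := stepsTo_one (M := M) (emb ()) v (allStacks x y S)
    rw [hM ()] at this
    simp only [code, TM2.stepAux] at this
    rwa [update_stacks] at this
  | mv a f bs S =>
    refine ⟨1, le_rfl, (S a).head?, ?_⟩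
    have := stepsTo_one (M := M) (emb ()) v (allStacks x y S)
    rw [hM ()] at this
    simp only [code, TM2.stepAux] at this
    rw [update_stacks] at this
    cases hS : S a with
    | nil =>
      have e : update S a [] = S := by rw [← hS, update_eq_self]
      simp only [allStacks, hS, List.head?_nil, List.tail_nil, Option.isSome_none, cond_false,
        e] at this
      simp only [mvState, hS]
      exact this
    | cons c l =>
      simp only [allStacks, hS, List.head?_cons, List.tail_cons, Option.isSome_some, cond_true] at this
      rw [stepAux_pushStmt] at this
      simp only [mvState, hS]
      exact this
  | @seq p q S S' S'' t t' _ _ ih ih' =>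
    obtain ⟨n, hn, v', h⟩ := ih (fun l => emb (.inl l)) (emb (.inr (entry q)))
      (fun l => hM (.inl l)) v
    obtain ⟨n', hn', v'', h'⟩ := ih' (fun l => emb (.inr l)) next (fun l => hM (.inr l)) v'
    exact ⟨n + n', by omega, v'', h.trans h'⟩
  | @ite_true a t p q S S' T ht _ ih =>
    obtain ⟨n, hn, v', h⟩ := ih (fun l => emb (some (.inl l))) next
      (fun l => hM (some (.inl l))) (S a).head?
    refine ⟨1 + n, by omega, v', StepsTo.trans ?_ h⟩
    have := stepsTo_one (M := M) (emb none) v (allStacks x y S)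
    rw [hM none] at this
    simp only [code, TM2.stepAux, allStacks, ht, cond_true] at this
    exact this
  | @ite_false a t p q S S' T ht _ ih =>
    obtain ⟨n, hn, v', h⟩ := ih (fun l => emb (some (.inr l))) next
      (fun l => hM (some (.inr l))) (S a).head?
    refine ⟨1 + n, by omega, v', StepsTo.trans ?_ h⟩
    have := stepsTo_one (M := M) (emb none) v (allStacks x y S)
    rw [hM none] at this
    simp only [code, TM2.stepAux, allStacks, ht, cond_false] at this
    exact this
  | @loop_true a t p S S' S'' T T' ht _ _ ih ih' =>
    obtain ⟨n, hn, v', h⟩ := ih (fun l => emb (some l)) (emb none)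
      (fun l => hM (some l)) (S a).head?
    obtain ⟨n', hn', v'', h'⟩ := ih' emb next hM v'
    refine ⟨1 + (n + n'), by omega, v'', StepsTo.trans ?_ (h.trans h')⟩
    have := stepsTo_one (M := M) (emb none) v (allStacks x y S)
    rw [hM none] at this
    simp only [code, TM2.stepAux, allStacks, ht, cond_true] at this
    exact this
  | @loop_false a t p S ht =>
    refine ⟨1, le_rfl, (S a).head?, ?_⟩
    have := stepsTo_one (M := M) (emb none) v (allStacks x y S)
    rw [hM none] at this
    simp only [code, TM2.stepAux, allStacks, ht, cond_false] at this
    exact this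
  | mono hn _ ih =>
    obtain ⟨n, hn', v', h⟩ := ih emb next hM v
    exact ⟨n, hn'.trans hn, v', h⟩

/-- The code of a machine that reads its input, transformed by `ι`, to the stack `a` (in reverse
order), runs `p`, and outputs whether the stack `r` is non-empty. -/
def machineCode [Inhabited α] (p : Prog V α) (ι : β → α) (a r : V) :
    Option (Option (Lab p)) → TM2.Stmt (Alph V α β) (Option (Option (Lab p))) (Option α)
  | none => .pop none (fun _ (o : Option β) => o.map ι)
      (.branch Option.isSome
        (.push (some (some a)) (fun s : Option α => s.getD default) (.goto fun _ => none))
        (.goto fun _ => some (some (entry p))))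
  | some none => .pop (some (some r)) (fun _ o => o)
      (.push (some none) (fun s : Option α => s.isSome) (.load (fun _ => none) .halt))
  | some (some l) => code p (fun l => some (some l)) (some none) l

lemma machineCode_read [Inhabited α] (p : Prog V α) (ι : β → α) (a r : V) (w : List β)
    (S : V → List α) (v : Option α) :
    ∃ v', StepsTo (machineCode p ι a r) (w.length + 1) ⟨some none, v, allStacks w [] S⟩
      ⟨some (some (some (entry p))), v',
        allStacks [] [] (update S a ((w.map ι).reverse ++ S a))⟩ := by
  induction w generalizing S v with
  | nil =>
    refine ⟨none, ?_⟩
    have := stepsTo_one (M := machineCode p ι a r) none v (allStacks ([] : List β) [] S)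
    simp only [machineCode, TM2.stepAux] at this
    rw [update_stacks_input] at this
    simpa [allStacks] using this
  | cons c w ih =>
    obtain ⟨v', h⟩ := ih (update S a (ι c :: S a)) (some (ι c))
    refine ⟨v', ?_⟩
    rw [List.length_cons, Nat.add_comm _ 1]
    refine StepsTo.trans (?_ : StepsTo _ 1 _
      ⟨some none, some (ι c), allStacks w [] (update S a (ι c :: S a))⟩) (by simpa using h)
    have := stepsTo_one (M := machineCode p ι a r) none v (allStacks (c :: w) [] S)
    simp only [machineCode, TM2.stepAux] at this
    rw [update_stacks_input] at this
    simp only [allStacks, List.head?_cons, Option.map_some, Option.isSome_some, cond_true,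
      Option.getD_some, List.tail_cons] at this
    rw [update_stacks] at this
    exact this

/-- The machine with code `machineCode p ι a r`. -/
noncomputable def machine [Fintype V] [Fintype α] [Fintype β] [Inhabited α] (p : Prog V α)
    (ι : β → α) (a r : V) : FinTM2 where
  K := Option (Option V)
  k₀ := none
  k₁ := some none
  Γ := Alph V α β
  Λ := Option (Option (Lab p))
  main := none
  ΛFin :=
    have := finite_lab p
    Fintype.ofFinite _
  σ := Option α
  initialState := none
  Γk₀Fin := inferInstanceAs (Fintype β)
  m := machineCode p ι a r

end Prog

open Prog in
/-- A language is in P if it is decided by a structured program in polynomial time. -/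
theorem inP_of_exec {V α β : Type} [DecidableEq V] [Fintype V] [Fintype α] [Fintype β]
    [Inhabited α] (L : Language β) (f : List β → Bool) (hf : ∀ w, f w = true ↔ w ∈ L)
    (p : Prog V α) (ι : β → α) (a r : V) (c : α) (T : Polynomial ℕ)
    (h : ∀ w, Exec p (update (fun _ => []) a (w.map ι).reverse) (T.eval w.length)
      (update (fun _ => []) r (if f w then [c] else []))) : InP L := by
  refine ⟨f, hf, ?_⟩
  -- Reading the input costs `w.length + 1` steps and writing the answer one. `haltList` asks for
  -- empty stacks apart from the output and for the initial register, which is why `p` must clean up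
  -- after itself and the last statement resets the register.
  have key : ∀ w : List β, ∃ n ≤ (T + Polynomial.X + 2).eval w.length,
      (flip bind (machine p ι a r).step)^[n]
        (some (initList (machine p ι a r) w)) =
        some (haltList (machine p ι a r) [f w]) := by
    intro w
    obtain ⟨v, h₁⟩ := machineCode_read p ι a r w (fun _ => []) none
    simp only [List.append_nil] at h₁
    obtain ⟨n, hn, v', h₂⟩ := (h w).stepsTo (M := machineCode p ι a r) [] []
      (fun l => some (some l)) (some none) (fun _ => rfl) v
    have h₃ := stepsTo_one (M := machineCode p ι a r) (some none) v'
      (allStacks [] [] (update (fun _ => []) r (if f w then [c] else [])))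
    have e : TM2.stepAux (machineCode p ι a r (some none)) v'
        (allStacks [] [] (update (fun _ => []) r (if f w then [c] else []))) =
        ⟨none, none, allStacks [] [f w] fun _ => []⟩ := by
      simp only [machineCode, TM2.stepAux]
      rw [update_stacks, update_stacks_output]
      by_cases hw : f w <;> simp [allStacks, hw]
    rw [e] at h₃
    refine ⟨w.length + 1 + n + 1, ?_, ?_⟩
    rotate_left
    · have h₄ := (h₁.trans h₂).trans h₃
      have e₁ : initList (machine p ι a r) w = (⟨some none, none, allStacks w [] fun _ => []⟩ :
          TM2.Cfg (Alph V α β) (Option (Option (Lab p))) (Option α)) := by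
        unfold initList
        congr 1
        funext k
        rcases k with _ | _ | k <;> rfl
      have e₂ : haltList (machine p ι a r) [f w] = (⟨none, none, allStacks [] [f w] fun _ => []⟩ :
          TM2.Cfg (Alph V α β) (Option (Option (Lab p))) (Option α)) := by
        unfold haltList
        congr 1
        funext k
        rcases k with _ | _ | k <;> rfl
      rw [e₁, e₂]
      exact h₄
    · simp only [Polynomial.eval_add, Polynomial.eval_X, Polynomial.eval_ofNat]
      omega
  choose n hn hs using key
  refine ⟨⟨⟨machine p ι a r, Equiv.refl β, Equiv.refl Bool⟩, T + Polynomial.X + 2,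
    fun w => ⟨⟨n w, ?_⟩, hn w⟩⟩, ?_⟩
  · have := hs w
    -- The input is passed through the identity equivalence of alphabets, that is, through `List.map
    -- id`.
    simp only [Computability.encodeBool]
    exact (congrArg (fun l : List β => (flip bind (machine p ι a r).step)^[n w]
      (some (initList (machine p ι a r) l))) (List.map_id w)).trans this
  · rintro (_ | _ | k)
    · exact inferInstanceAs (Finite β)
    · exact inferInstanceAs (Finite Bool)
    · exact inferInstanceAs (Finite α)

end ABA

/-! ### Basic stack programs with their running times -/

namespace ABA

open Function

namespace Prog

variable {V α : Type} [DecidableEq V]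

lemma Exec.of_eq {p : Prog V α} {S S' S'' : V → List α} {n n' : ℕ} (h : Exec p S n S')
    (hS : S' = S'') (hn : n ≤ n') : Exec p S n' S'' :=
  hS ▸ h.mono hn

lemma update_of_eq {S : V → List α} {a : V} {l : List α} (h : S a = l) : update S a l = S := by
  rw [← h, update_eq_self]

/-- Move all entries of `a`, transformed by `f`, to `b`, which reverses their order. -/
def move (a : V) (f : α → α) (b : V) : Prog V α :=
  loop a Option.isSome (mv a f [b])

/-- Empty the stack `a`. -/
def clear (a : V) : Prog V α :=
  loop a Option.isSome (mv a id [])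

/-- Copy `a` to `b`, using the empty stack `c`. -/
def copy (a b c : V) : Prog V α :=
  seq (move a id c) (loop c Option.isSome (mv c id [a, b]))

lemma exec_pop (a : V) (f : α → α) (S : V → List α) :
    Exec (mv a f []) S 1 (update S a (S a).tail) := by
  refine (Exec.mv a f [] S).of_eq ?_ le_rfl
  cases h : S a with
  | nil => simp [mvState, h, update_of_eq h]
  | cons c l => simp [mvState, h, pushAll]

lemma exec_move {a b : V} (hab : a ≠ b) (f : α → α) (S : V → List α) :
    Exec (move a f b) S (2 * (S a).length + 1)
      (update (update S b (((S a).map f).reverse ++ S b)) a []) := by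
  generalize h : S a = l
  induction l generalizing S with
  | nil =>
    refine (Exec.loop_false (by simp [h])).of_eq ?_ (by simp)
    simp [update_of_eq h]
  | cons c l ih =>
    have hm := Exec.mv a f [b] S
    simp only [mvState, h, pushAll] at hm
    refine (Exec.loop_true (by simp [h]) hm (ih _ ?_)).of_eq ?_ ?_
    · simp [update_of_ne hab]
    · funext k
      by_cases hk : k = a
      · subst hk; simp
      · by_cases hk' : k = b
        · subst hk'; simp [hk]
        · simp [hk, hk']
    · simp only [List.length_cons]; omega

lemma exec_clear (a : V) (S : V → List α) :
    Exec (clear a) S (2 * (S a).length + 1) (update S a []) := by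
  generalize h : S a = l
  induction l generalizing S with
  | nil =>
    exact (Exec.loop_false (by simp [h])).of_eq (by simp [update_of_eq h]) (by simp)
  | cons c l ih =>
    refine (Exec.loop_true (by simp [h]) (exec_pop a id S) (ih _ ?_)).of_eq ?_ ?_
    · simp [h]
    · simp
    · simp only [List.length_cons]; omega

lemma exec_distribute {a b c : V} (hab : a ≠ b) (hac : a ≠ c) (hbc : b ≠ c) (S : V → List α) :
    Exec (loop c Option.isSome (mv c id [a, b])) S (2 * (S c).length + 1)
      (update (update (update S b ((S c).reverse ++ S b)) a ((S c).reverse ++ S a)) c []) := by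
  generalize h : S c = l
  induction l generalizing S with
  | nil =>
    refine (Exec.loop_false (by simp [h])).of_eq ?_ (by simp)
    simp [update_of_eq h]
  | cons x l ih =>
    have hm := Exec.mv c id [a, b] S
    simp only [mvState, h, pushAll] at hm
    refine (Exec.loop_true (by simp [h]) hm (ih _ ?_)).of_eq ?_ ?_
    · simp [hac.symm, hbc.symm]
    · funext k
      by_cases hk : k = c
      · subst hk; simp
      · by_cases hk' : k = a
        · subst hk'; simp [hk, hab]
        · by_cases hk'' : k = b
          · subst hk''; simp [hk, hk']
          · simp [hk, hk', hk'']
    · simp only [List.length_cons]; omega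

lemma exec_copy {a b c : V} (hab : a ≠ b) (hac : a ≠ c) (hbc : b ≠ c) (S : V → List α)
    (hb : S b = []) (hc : S c = []) :
    Exec (copy a b c) S (4 * (S a).length + 2) (update S b (S a)) := by
  refine (Exec.seq (exec_move hac id S) (exec_distribute hab hac hbc _)).of_eq ?_ ?_
  · funext k
    by_cases hk : k = c
    · subst hk; simp [hc, hbc.symm]
    · by_cases hk' : k = a
      · subst hk'; simp [hk, hab, hac.symm, hc]
      · by_cases hk'' : k = b
        · subst hk''; simp [hk, hk', hac.symm, hc, hb]
        · simp [hk, hk', hk'']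
  · simp [hac.symm, hc]; omega

lemma exec_dropWhile (a : V) (t : α → Bool) (S : V → List α) :
    Exec (loop a (fun o => o.any t) (mv a id [])) S (2 * (S a).length + 1)
      (update S a ((S a).dropWhile t)) := by
  generalize h : S a = l
  induction l generalizing S with
  | nil =>
    exact (Exec.loop_false (by simp [h])).of_eq (by simp [update_of_eq h]) (by simp)
  | cons c l ih =>
    by_cases hc : t c
    · refine (Exec.loop_true (by simp [h, hc]) (exec_pop a id S) (ih _ ?_)).of_eq ?_ ?_
      · simp [h]
      · simp [hc]
      · simp only [List.length_cons]; omega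
    · exact (Exec.loop_false (by simp [h, hc])).of_eq (by simp [hc, update_of_eq h]) (by simp)

end Prog

/-! ### First-order formulas about annotated words and their evaluation -/

namespace Symbol

/-- Is the symbol a bit? -/
def isBit : Symbol → Bool
  | bit _ => true
  | _ => false

end Symbol

/-- The bits after the first symbol. -/
def fieldBits (x : List Symbol) : List Symbol :=
  x.tail.takeWhile Symbol.isBit

/-- The part of the word that starts with the first mark after its first symbol. -/
def nextField (x : List Symbol) : List Symbol :=
  x.tail.dropWhile Symbol.isBit

open Classical in
/-- The word `x`, annotated at each position by whether the rest of the word satisfies `Q`. -/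
noncomputable def annotate (Q : List Symbol → Prop) : List Symbol → List (Symbol × Bool)
  | [] => []
  | c :: x => (c, decide (Q (c :: x))) :: annotate Q x

section annotate

variable (Q : List Symbol → Prop) (x : List Symbol)

@[simp] lemma length_annotate : (annotate Q x).length = x.length := by
  induction x with
  | nil => rfl
  | cons c x ih => simp [annotate, ih]

@[simp] lemma annotate_nil : annotate Q [] = [] := rfl

/-- The label of a position depends only on the suffix that starts there, so annotating commutes
with passing to a suffix. A stack holding a suffix thus shows the value of `Q` at its top. -/
lemma annotate_tail : (annotate Q x).tail = annotate Q x.tail := by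
  cases x <;> rfl

lemma annotate_dropWhile (t : Symbol → Bool) :
    (annotate Q x).dropWhile (fun c => t c.1) = annotate Q (x.dropWhile t) := by
  induction x with
  | nil => rfl
  | cons c x ih => by_cases h : t c <;> simp [annotate, h, ih]

lemma annotate_head : (annotate Q x).head?.map Prod.fst = x.head? := by
  cases x <;> rfl

lemma annotate_any : (annotate Q x).head?.any Prod.snd = true ↔ x ≠ [] ∧ Q x := by
  cases x <;> simp [annotate]

end annotate

/-- The stacks used to evaluate a formula with `m` variables. -/
inductive Reg (m : ℕ)
  | var (i : Fin m)
  | word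
  | tmp
  | left
  | right
  | res
  | new
  | ctr
  deriving DecidableEq, Fintype

/-- Formulas about a word, with variables for parts of the word, and one predicate. -/
inductive Fm (m : ℕ)
  | head (t : Option Symbol → Bool) (x : Fin m)
  | ann (x : Fin m)
  | eqf (x y : Fin m)
  | neg (φ : Fm m)
  | and (φ ψ : Fm m)
  | ex (n : Fin m) (φ : Fm m)
  | nxt (n x : Fin m) (φ : Fm m)

namespace Fm

open Prog

variable {m : ℕ}

/-- Satisfaction: `ex n φ` quantifies over the non-empty suffixes of the word, and `nxt n x φ`
binds the variable `n` to the field after `x`. -/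
def Sat (w : List Symbol) (Q : List Symbol → Prop) : Fm m → (Fin m → List Symbol) → Prop
  | head t x, v => t (v x).head? = true
  | ann x, v => v x ≠ [] ∧ Q (v x)
  | eqf x y, v => fieldBits (v x) = fieldBits (v y)
  | neg φ, v => ¬ Sat w Q φ v
  | and φ ψ, v => Sat w Q φ v ∧ Sat w Q ψ v
  | ex n φ, v => ∃ x, x <:+ w ∧ x ≠ [] ∧ Sat w Q φ (update v n x)
  | nxt n x φ, v => Sat w Q φ (update v n (nextField (v x)))

/-- The bound variables. -/
def bv : Fm m → List (Fin m)
  | head _ _ => []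
  | ann _ => []
  | eqf _ _ => []
  | neg φ => bv φ
  | and φ ψ => bv φ ++ bv ψ
  | ex n φ => n :: bv φ
  | nxt n _ φ => n :: bv φ

/-- No variable is bound again in the scope of a quantifier that binds it. -/
def WF : Fm m → Prop
  | head _ _ => True
  | ann _ => True
  | eqf _ _ => True
  | neg φ => WF φ
  | and φ ψ => WF φ ∧ WF ψ
  | ex n φ => n ∉ bv φ ∧ WF φ
  | nxt n x φ => n ≠ x ∧ n ∉ bv φ ∧ WF φ

/-- The representation of a truth value on a stack. -/
def flag (b : Bool) : List (Symbol × Bool) :=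
  if b then [(Symbol.sentence, false)] else []

/-- Store a truth value. -/
def setRes (b : Bool) : Prog (Reg m) (Symbol × Bool) :=
  seq (mv .res id []) (if b then push .res (Symbol.sentence, false) else skip)

/-- Remove the first bit of the stacks `left` and `right` if it is the same. -/
def cmpBit : Prog (Reg m) (Symbol × Bool) :=
  ite .left (fun o => o.any fun c => c.1 = .bit true)
    (ite .right (fun o => o.any fun c => c.1 = .bit true)
      (seq (mv .left id []) (mv .right id [])) (seq (clear .left) (setRes false)))
    (ite .right (fun o => o.any fun c => c.1 = .bit false)
      (seq (mv .left id []) (mv .right id [])) (seq (clear .left) (setRes false)))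

/-- Compare the leading bits of the stacks `left` and `right`. -/
def cmpBits : Prog (Reg m) (Symbol × Bool) :=
  seq (setRes true) (seq (loop .left (fun o => o.any fun c => c.1.isBit) cmpBit)
    (seq (ite .right (fun o => o.any fun c => c.1.isBit) (setRes false) skip)
      (seq (clear .left) (clear .right))))

/-- The program that evaluates a formula. -/
def comp : Fm m → Prog (Reg m) (Symbol × Bool)
  | head t x => ite (.var x) (fun o => t (o.map Prod.fst)) (setRes true) (setRes false)
  | ann x => ite (.var x) (fun o => o.any Prod.snd) (setRes true) (setRes false)
  | eqf x y => seq (copy (.var x) .left .tmp) (seq (copy (.var y) .right .tmp)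
      (seq (mv .left id []) (seq (mv .right id []) cmpBits)))
  | neg φ => seq (comp φ) (ite .res Option.isSome (setRes false) (setRes true))
  | and φ ψ => seq (comp φ) (ite .res Option.isSome (comp ψ) skip)
  | ex n φ => seq (copy .word (.var n) .tmp) (seq (setRes false)
      (loop (.var n) Option.isSome (seq (comp φ)
        (ite .res Option.isSome (clear (.var n)) (mv (.var n) id [])))))
  | nxt n x φ => seq (copy (.var x) (.var n) .tmp) (seq (mv (.var n) id [])
      (seq (loop (.var n) (fun o => o.any fun c => c.1.isBit) (mv (.var n) id []))
        (seq (comp φ) (clear (.var n)))))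

/-- A bound for the running time of `comp`. -/
noncomputable def time : Fm m → Polynomial ℕ
  | head _ _ => 3
  | ann _ => 3
  | eqf _ _ => 30 * Polynomial.X + 30
  | neg φ => time φ + 3
  | and φ ψ => time φ + time ψ + 2
  | ex _ φ => 4 * Polynomial.X + 5 + Polynomial.X * (time φ + 2 * Polynomial.X + 4)
  | nxt _ _ φ => time φ + 8 * Polynomial.X + 10

lemma exec_setRes (b b' : Bool) (S : Reg m → List (Symbol × Bool)) :
    Exec (setRes b') (update S .res (flag b)) 2 (update S .res (flag b')) := by
  have h : Exec (mv .res id []) (update S .res (flag b)) 1 (update S .res []) := by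
    refine (exec_pop _ _ _).of_eq ?_ le_rfl
    cases b <;> simp [flag]
  cases b'
  · exact h.seq (Exec.skip _)
  · refine (h.seq (Exec.push _ _ _)).of_eq ?_ le_rfl
    simp [flag]

/-- `S` holds the word `w` and the values of the variables, and the auxiliary stacks are empty. -/
structure Holds (S : Reg m → List (Symbol × Bool)) (w : List Symbol) (Q : List Symbol → Prop)
    (v : Fin m → List Symbol) : Prop where
  word : S .word = annotate Q w
  var : ∀ i, S (.var i) = annotate Q (v i)
  tmp : S .tmp = []
  left : S .left = []
  right : S .right = []

lemma Holds.update {S : Reg m → List (Symbol × Bool)} {w : List Symbol} {Q : List Symbol → Prop}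
    {v : Fin m → List Symbol} (h : Holds S w Q v) (n : Fin m) (x : List Symbol) :
    Holds (update S (.var n) (annotate Q x)) w Q (Function.update v n x) := by
  refine ⟨by simp [h.word], fun i => ?_, by simp [h.tmp], by simp [h.left], by simp [h.right]⟩
  by_cases hi : i = n
  · subst hi; simp
  · simp [hi, h.var]

/-- The leading bits of a stack. -/
def leadingBits (l : List (Symbol × Bool)) : List Symbol :=
  (l.map Prod.fst).takeWhile Symbol.isBit

lemma leadingBits_annotate (Q : List Symbol → Prop) (x : List Symbol) :
    leadingBits (annotate Q x) = x.takeWhile Symbol.isBit := by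
  have : (annotate Q x).map Prod.fst = x := by
    induction x with
    | nil => rfl
    | cons c x ih => simp [annotate, ih]
  rw [leadingBits, this]

lemma exec_cmpBit_eq (S : Reg m → List (Symbol × Bool)) (s : Bool) (c c' : Bool)
    (l l' : List (Symbol × Bool)) (hl : S .left = (Symbol.bit s, c) :: l)
    (hr : S .right = (Symbol.bit s, c') :: l') :
    Exec cmpBit S 4 (update (update S .left l) .right l') := by
  have h : Exec (seq (mv .left id []) (mv .right id [])) S 2
      (update (update S .left l) .right l') := by
    refine ((exec_pop _ _ _).seq (exec_pop _ _ _)).of_eq ?_ le_rfl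
    simp [hl, hr]
  cases s
  · exact Exec.ite_false (by simp [hl]) (Exec.ite_true (by simp [hr]) h)
  · exact Exec.ite_true (by simp [hl]) (Exec.ite_true (by simp [hr]) h)

/-- A mismatch empties `left`, so that the enclosing comparison loop stops with the result false.
The hypothesis on `right` also covers the cases that it is empty or starts with a mark. -/
lemma exec_cmpBit_ne (S : Reg m → List (Symbol × Bool)) (s : Bool) (c : Bool)
    (l : List (Symbol × Bool)) (b : Bool) (hl : S .left = (Symbol.bit s, c) :: l)
    (hr : (S .right).head?.map Prod.fst ≠ some (Symbol.bit s)) :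
    Exec cmpBit (update S .res (flag b)) (2 * l.length + 7)
      (update (update S .left []) .res (flag false)) := by
  have h : Exec (seq (clear .left) (setRes false)) (update S .res (flag b)) (2 * l.length + 5)
      (update (update S .left []) .res (flag false)) := by
    have h₁ := exec_clear Reg.left (update S .res (flag b))
    rw [update_comm (by simp)] at h₁
    refine (h₁.seq (exec_setRes _ _ _)).of_eq rfl ?_
    simp [hl]; omega
  have hr' : ((S .right).head?.any fun c => c.1 = Symbol.bit s) = false := by
    cases h : S .right <;> simp_all
  cases s
  · exact Exec.ite_false (by simp [hl]) (Exec.ite_false (by simpa using hr') h)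
  · exact Exec.ite_true (by simp [hl]) (Exec.ite_false (by simpa using hr') h)

/-- If no mismatch occurs, the leading bits of `left` have been matched against the front of
`right`, and equality then means that the remainder `l₂` does not start with a bit. The remainders
are cleared later, so only their lengths are recorded. -/
lemma exec_cmpLoop (l : List (Symbol × Bool)) (S : Reg m → List (Symbol × Bool))
    (hl : S .left = l) :
    ∃ b l₁ l₂, l₁.length ≤ l.length ∧ l₂.length ≤ (S .right).length ∧
      ((b = true ∧ ¬ l₂.head?.any (fun c => c.1.isBit) = true) ↔
        leadingBits l = leadingBits (S .right)) ∧
      Exec (loop .left (fun o => o.any fun c => c.1.isBit) cmpBit) (update S .res (flag true))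
        (7 * l.length + 8)
        (update (update (update S .left l₁) .right l₂) .res (flag b)) := by
  induction l generalizing S with
  | nil =>
    refine ⟨true, [], S .right, le_rfl, le_rfl, ?_, ?_⟩
    · cases h : S .right with
      | nil => simp [leadingBits]
      | cons c l => cases hc : c.1.isBit <;> simp [leadingBits, hc]
    · exact (Exec.loop_false (by simp [hl])).of_eq (by simp [update_of_eq hl]) (by simp)
  | cons c l ih =>
    obtain ⟨s, a⟩ := c
    by_cases hc : s.isBit
    · obtain ⟨b, rfl⟩ : ∃ b, s = Symbol.bit b := by cases s <;> simp_all [Symbol.isBit]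
      by_cases hr : (S .right).head?.map Prod.fst = some (Symbol.bit b)
      · obtain ⟨a', l', hr⟩ : ∃ a' l', S .right = (Symbol.bit b, a') :: l' := by
          cases h : S .right with
          | nil => simp [h] at hr
          | cons c l => exact ⟨c.2, l, by simp [h] at hr; rw [← hr]⟩
        obtain ⟨b', l₁, l₂, h₁, h₂, h, he⟩ := ih (update (update S .left l) .right l') (by simp)
        have hs := exec_cmpBit_eq (update S .res (flag true)) b a a' l l' (by simp [hl])
          (by simp [hr])
        have e : update (update (update S Reg.res (flag true)) Reg.left l) Reg.right l' =
            update (update (update S .left l) .right l') .res (flag true) := by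
          rw [update_comm (a := Reg.res) (by simp), update_comm (a := Reg.res) (by simp)]
        rw [e] at hs
        refine ⟨b', l₁, l₂, by simp; omega, by simp [hr] at h₂ ⊢; omega, ?_, ?_⟩
        · rw [h]; simp [leadingBits, hr, hc]
        · refine (Exec.loop_true (by simp [hl, hc]) hs he).of_eq ?_ ?_
          · congr 1
            rw [update_comm (a := Reg.left) (by simp), update_idem,
              update_comm (a := Reg.right) (by simp), update_idem]
          · simp only [List.length_cons]; omega
      · refine ⟨false, [], S .right, by simp, le_rfl, ?_, ?_⟩
        · simp only [Bool.false_eq_true, false_and, false_iff]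
          intro h
          cases h' : S .right with
          | nil => simp [h', leadingBits, Symbol.isBit] at h
          | cons c l =>
            cases hc' : c.1.isBit
            · simp [h', leadingBits, hc, hc'] at h
            · simp [h', leadingBits, hc, hc'] at h
              simp [h', ← h.1] at hr
        · refine (Exec.loop_true (by simp [hl, hc]) (exec_cmpBit_ne S b a l true hl hr)
            (Exec.loop_false (by simp))).of_eq ?_ ?_
          · congr 1
            exact (update_of_eq (by simp)).symm
          · simp only [List.length_cons]; omega
    · refine ⟨true, (s, a) :: l, S .right, le_rfl, le_rfl, ?_, ?_⟩
      · cases h : S .right with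
        | nil => simp [leadingBits, hc]
        | cons c l => cases hc' : c.1.isBit <;> simp [leadingBits, hc, hc']
      · exact (Exec.loop_false (by simp [hl, hc])).of_eq (by simp [update_of_eq hl]) (by simp)

open Classical in
lemma exec_cmpBits (S : Reg m → List (Symbol × Bool)) (b : Bool) :
    Exec cmpBits (update S .res (flag b)) (9 * (S .left).length + 2 * (S .right).length + 15)
      (update (update (update S .left []) .right []) .res
        (flag (decide (leadingBits (S .left) = leadingBits (S .right))))) := by
  obtain ⟨b', l₁, l₂, h₁, h₂, h, he⟩ := exec_cmpLoop (S .left) S rfl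
  set S₁ := update (update S .left l₁) .right l₂ with hS₁
  have hi : Exec (ite .right (fun o => o.any fun c => c.1.isBit) (setRes false) skip)
      (update S₁ .res (flag b')) 3 (update S₁ .res
        (flag (decide (leadingBits (S .left) = leadingBits (S .right))))) := by
    by_cases hb : l₂.head?.any (fun c => c.1.isBit) = true
    · refine (Exec.ite_true (by simpa [hS₁] using hb) (exec_setRes b' false S₁)).of_eq ?_ le_rfl
      rw [decide_eq_false]
      rw [← h]; simp [hb]
    · refine (Exec.ite_false (by simpa [hS₁] using hb) (Exec.skip _)).of_eq ?_ (by omega)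
      congr 2
      rw [eq_comm, Bool.eq_iff_iff, decide_eq_true_iff, ← h]
      simp [hb]
  refine ((exec_setRes b true S).seq (he.seq (hi.seq
    ((exec_clear _ _).seq (exec_clear _ _))))).of_eq ?_ ?_
  · funext r
    cases r <;> simp [hS₁]
  · simp [hS₁]; omega

-- Induction on the formula. All stacks except `res` are restored, so that evaluations can be
-- composed and repeated. Bound variables have empty stacks at the start; quantifiers use these as
-- working space, and `WF` keeps this true inside their scope.
open Classical in
theorem exec_comp (φ : Fm m) (w : List Symbol) (Q : List Symbol → Prop) (N : ℕ)
    (hN : w.length ≤ N) (hφ : φ.WF) (v : Fin m → List Symbol) (hv : ∀ i, (v i).length ≤ N)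
    (hb : ∀ n ∈ φ.bv, v n = []) (S : Reg m → List (Symbol × Bool)) (hS : Holds S w Q v)
    (b : Bool) :
    Exec φ.comp (update S .res (flag b)) (φ.time.eval N)
      (update S .res (flag (decide (φ.Sat w Q v)))) := by
  induction φ generalizing v S b with
  | head t x =>
    by_cases h : t (v x).head? = true
    · refine (Exec.ite_true ?_ (exec_setRes b true S)).of_eq ?_ (by simp [time])
      · simpa [hS.var, annotate_head] using h
      · simp [Sat, h]
    · refine (Exec.ite_false ?_ (exec_setRes b false S)).of_eq ?_ (by simp [time])
      · simpa [hS.var, annotate_head] using h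
      · simp [Sat, h]
  | ann x =>
    have e := annotate_any Q (v x)
    by_cases h : v x ≠ [] ∧ Q (v x)
    · refine (Exec.ite_true ?_ (exec_setRes b true S)).of_eq ?_ (by simp [time])
      · simpa [hS.var] using e.2 h
      · simp [Sat, h]
    · refine (Exec.ite_false ?_ (exec_setRes b false S)).of_eq ?_ (by simp [time])
      · simpa [hS.var] using (not_congr e).2 h
      · simp [Sat, h]
  | eqf x y =>
    have hx := hv x
    have hy := hv y
    have h₁ : Exec (copy (.var x) .left .tmp) (update S .res (flag b)) (4 * N + 2)
        (update (update S .left (annotate Q (v x))) .res (flag b)) := by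
      refine (exec_copy (by simp) (by simp) (by simp) _ (by simp [hS.left])
        (by simp [hS.tmp])).of_eq ?_ ?_
      · rw [update_comm (by simp)]; simp [hS.var]
      · simp [hS.var, hx]
    set S₁ := update S .left (annotate Q (v x)) with hS₁
    have h₂ : Exec (copy (.var y) .right .tmp) (update S₁ .res (flag b)) (4 * N + 2)
        (update (update S₁ .right (annotate Q (v y))) .res (flag b)) := by
      refine (exec_copy (by simp) (by simp) (by simp) _ (by simp [hS₁, hS.right])
        (by simp [hS₁, hS.tmp])).of_eq ?_ ?_
      · rw [update_comm (by simp)]; simp [hS₁, hS.var]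
      · simp [hS₁, hS.var, hy]
    set S₂ := update S₁ .right (annotate Q (v y)) with hS₂
    have h₃ : Exec (mv .left id []) (update S₂ .res (flag b)) 1
        (update (update S₂ .left (annotate Q (v x).tail)) .res (flag b)) := by
      refine (exec_pop _ _ _).of_eq ?_ le_rfl
      rw [update_comm (by simp)]; simp [hS₂, hS₁, annotate_tail]
    set S₃ := update S₂ .left (annotate Q (v x).tail) with hS₃
    have h₄ : Exec (mv .right id []) (update S₃ .res (flag b)) 1
        (update (update S₃ .right (annotate Q (v y).tail)) .res (flag b)) := by
      refine (exec_pop _ _ _).of_eq ?_ le_rfl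
      rw [update_comm (by simp)]; simp [hS₃, hS₂, annotate_tail]
    refine (h₁.seq (h₂.seq (h₃.seq (h₄.seq (exec_cmpBits _ b))))).of_eq ?_ ?_
    · funext r
      cases r <;> simp [hS₁, hS₂, hS₃, hS.left, hS.right, leadingBits_annotate, Sat, fieldBits]
      -- The two propositions agree by definition; the instances that decide them need not.
      exact congrArg flag (decide_eq_decide.2 Iff.rfl)
    · simp [hS₃, time]; omega
  | neg φ ih => 
    have h := ih hφ v hv hb S hS b
    by_cases hs : φ.Sat w Q v
    · refine (h.seq (Exec.ite_true ?_ (exec_setRes _ false S))).of_eq ?_ (by simp [time])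
      · simp [hs, flag]
      · simp [Sat, hs]
    · refine (h.seq (Exec.ite_false ?_ (exec_setRes _ true S))).of_eq ?_ (by simp [time])
      · simp [hs, flag]
      · simp [Sat, hs]
  | and φ ψ ih ih' =>
    simp only [bv, List.mem_append] at hb
    have h := ih hφ.1 v hv (fun n hn => hb n (.inl hn)) S hS b
    by_cases hs : φ.Sat w Q v
    · refine (h.seq (Exec.ite_true ?_ (ih' hφ.2 v hv (fun n hn => hb n (.inr hn)) S hS _))).of_eq
        ?_ ?_
      · simp [hs, flag]
      · simp [Sat, hs]
      · simp [time]; omega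
    · refine (h.seq (Exec.ite_false ?_ (Exec.skip _))).of_eq ?_ ?_
      · simp [hs, flag]
      · simp [Sat, hs]
      · simp [time]
  | ex n φ ih =>
    have hn : v n = [] := hb n (by simp [bv])
    have hSn : S (.var n) = [] := by simp [hS.var, hn]
    have h₁ : Exec (copy .word (.var n) .tmp) (update S .res (flag b)) (4 * N + 2)
        (update (update S (.var n) (annotate Q w)) .res (flag b)) := by
      refine (exec_copy (by simp) (by simp) (by simp) _ (by simp [hSn])
        (by simp [hS.tmp])).of_eq ?_ ?_
      · rw [update_comm (by simp)]; simp [hS.word]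
      · simp [hS.word, hN]
    -- Here `x` is the longest suffix not yet tried. Popping a letter passes to the next suffix;
    -- success clears the stack of `n`, which ends the loop. The summand `2 * N` pays for this
    -- clearing.
    have hloop : ∀ x : List Symbol, x.length ≤ N → Exec (loop (.var n) Option.isSome
        (seq (comp φ) (ite .res Option.isSome (clear (.var n)) (mv (.var n) id []))))
        (update (update S (.var n) (annotate Q x)) .res (flag false))
        (x.length * (φ.time.eval N + 2 * N + 4) + 1)
        (update S .res (flag (decide
          (∃ y, y <:+ x ∧ y ≠ [] ∧ φ.Sat w Q (update v n y))))) := by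
      intro x hx
      induction x with
      | nil =>
        refine (Exec.loop_false (by simp)).of_eq ?_ (by simp)
        simp [update_of_eq hSn]
      | cons c x ihx =>
        have h := ih hφ.2 (update v n (c :: x))
          (fun i => by by_cases hi : i = n <;> simp_all)
          (fun i hi => by
            rw [update_of_ne (ne_of_mem_of_not_mem hi hφ.1)]
            exact hb i (by simp [bv, hi])) _ (hS.update n (c :: x)) false
        rw [List.length_cons] at hx
        have e : (∃ y, y <:+ c :: x ∧ y ≠ [] ∧ φ.Sat w Q (update v n y)) ↔
            φ.Sat w Q (update v n (c :: x)) ∨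
              ∃ y, y <:+ x ∧ y ≠ [] ∧ φ.Sat w Q (update v n y) := by
          simp only [List.suffix_cons_iff]
          constructor
          · rintro ⟨y, rfl | hy, h⟩
            · exact .inl h.2
            · exact .inr ⟨y, hy, h⟩
          · rintro (h | ⟨y, hy, h⟩)
            · exact ⟨_, .inl rfl, by simp, h⟩
            · exact ⟨y, .inr hy, h⟩
        by_cases hs : φ.Sat w Q (update v n (c :: x))
        · refine (Exec.loop_true (by simp [annotate]) (h.seq (Exec.ite_true (by simp [hs, flag])
            (exec_clear _ _))) (Exec.loop_false (by simp))).of_eq ?_ ?_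
          · rw [update_comm (by simp)]
            simp [e, hs, update_of_eq hSn]
          · simp only [ne_eq, reduceCtorEq, not_false_eq_true, update_of_ne, update_self,
              length_annotate, List.length_cons]
            nlinarith
        · have hp : Exec (mv (.var n) id []) (update (update S (.var n) (annotate Q (c :: x))) .res
              (flag (decide (φ.Sat w Q (update v n (c :: x)))))) 1
              (update (update S (.var n) (annotate Q x)) .res (flag false)) := by
            refine (exec_pop _ _ _).of_eq ?_ le_rfl
            rw [update_comm (by simp)]
            simp [hs, annotate]
          refine (Exec.loop_true (by simp [annotate]) (h.seq (Exec.ite_false (by simp [hs, flag])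
            hp)) (ihx (by omega))).of_eq ?_ ?_
          · simp only [e, hs, false_or]
          · rw [List.length_cons]
            nlinarith
    refine (h₁.seq ((exec_setRes b false _).seq (hloop w hN))).of_eq rfl ?_
    simp only [time, Polynomial.eval_add, Polynomial.eval_mul, Polynomial.eval_X,
      Polynomial.eval_ofNat]
    nlinarith [Nat.mul_le_mul_right (φ.time.eval N + 2 * N + 4) hN]
  | nxt n x φ ih =>
    have hn : v n = [] := hb n (by simp [bv])
    have hSn : S (.var n) = [] := by simp [hS.var, hn]
    have hnx : n ≠ x := hφ.1
    have hx := hv x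
    have h₁ : Exec (copy (.var x) (.var n) .tmp) (update S .res (flag b)) (4 * N + 2)
        (update (update S .res (flag b)) (.var n) (annotate Q (v x))) := by
      refine (exec_copy (by simpa using hnx.symm) (by simp) (by simp) _ (by simp [hSn])
        (by simp [hS.tmp])).of_eq ?_ ?_
      · simp [hS.var]
      · simp [hS.var, hx]
    have h₂ := exec_pop (.var n) id (update (update S .res (flag b)) (.var n) (annotate Q (v x)))
    have h₃ := exec_dropWhile (.var n) (fun c : Symbol × Bool => c.1.isBit) (update (update
      (update S .res (flag b)) (.var n) (annotate Q (v x))) (.var n)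
        (update (update S .res (flag b)) (.var n) (annotate Q (v x)) (.var n)).tail)
    simp only [update_self, annotate_tail, annotate_dropWhile, update_idem] at h₂ h₃
    -- Popping the mark and then the bits after it is the definition of `nextField`.
    change Exec _ _ _ (update _ _ (annotate Q (nextField (v x)))) at h₃
    have h₃ := h₃.of_eq (update_comm (by simp) _ _ _) le_rfl
    have hlen : (nextField (v x)).length ≤ N :=
      (List.length_dropWhile_le _ _).trans ((by simp : (v x).tail.length ≤ (v x).length).trans hx)
    have h₄ := ih hφ.2.2 (update v n (nextField (v x)))
      (fun i => by by_cases hi : i = n <;> simp_all)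
      (fun i hi => by
        rw [update_of_ne (ne_of_mem_of_not_mem hi hφ.2.1)]
        exact hb i (by simp [bv, hi])) _ (hS.update n (nextField (v x))) b
    refine (h₁.seq (h₂.seq (h₃.seq (h₄.seq (exec_clear _ _))))).of_eq ?_ ?_
    · rw [update_comm (by simp)]
      simp only [update_idem, update_of_eq hSn]
      exact congrArg (fun c => update S .res (flag c)) (decide_eq_decide.2 Iff.rfl)
    · have : (v x).length - 1 ≤ N := by omega
      simp [time]; omega

end Fm

end ABA

/-! ### Iterating a definable predicate -/

namespace ABA

open Function

namespace Fm

open Prog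

variable {m : ℕ}

/-- Replace the annotation of each position of the word by the truth value of `φ`, with the
position as the value of the variable `n`. -/
def relabel (n : Fin m) (φ : Fm m) : Prog (Reg m) (Symbol × Bool) :=
  seq (copy .word (.var n) .tmp) (seq
    (loop (.var n) Option.isSome (seq (comp φ) (ite .res Option.isSome
      (mv (.var n) (fun c => (c.1, true)) [.new]) (mv (.var n) (fun c => (c.1, false)) [.new]))))
    (seq (clear .word) (move .new id .word)))

/-- The predicate defined by `φ` with the variable `n`. -/
def next (n : Fin m) (φ : Fm m) (w : List Symbol) (Q : List Symbol → Prop) (x : List Symbol) :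
    Prop :=
  Sat w Q φ (update (fun _ => []) n x)

/-- All positions must be updated simultaneously: `φ` keeps reading the old labels on `word` and
`var n`, while the new ones are collected on `new`, in reverse order. The last truth value left on
`res` is irrelevant, hence the existential `b'`. -/
lemma exec_relabelLoop {n : Fin m} {φ : Fm m} (hφ : φ.WF) (hn : n ∉ φ.bv) {w : List Symbol}
    {Q : List Symbol → Prop} {N : ℕ} (hN : w.length ≤ N) (x : List Symbol) (hx : x.length ≤ N)
    (S : Reg m → List (Symbol × Bool)) (hS : Holds S w Q fun _ => []) (b : Bool) :
    ∃ b', Exec (loop (.var n) Option.isSome (seq (comp φ) (ite .res Option.isSome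
      (mv (.var n) (fun c => (c.1, true)) [.new]) (mv (.var n) (fun c => (c.1, false)) [.new]))))
      (update (update S (.var n) (annotate Q x)) .res (flag b))
      (x.length * (φ.time.eval N + 3) + 1)
      (update (update S .new ((annotate (next n φ w Q) x).reverse ++ S .new)) .res (flag b')) := by
  classical
  induction x generalizing S b with
  | nil =>
    refine ⟨b, (Exec.loop_false (by simp [annotate])).of_eq ?_ (by simp)⟩
    simp [annotate, update_of_eq (S := S) (a := .var n) (l := []) (by simp [hS.var, annotate])]
  | cons c x ih =>
    rw [List.length_cons] at hx
    have hSn : S (.var n) = [] := by simp [hS.var, annotate]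
    have h := exec_comp φ w Q N hN hφ (update (fun _ => []) n (c :: x))
      (fun i => by by_cases hi : i = n <;> simp [hi, hx])
      (fun i hi => by rw [update_of_ne (ne_of_mem_of_not_mem hi hn)]) _ (hS.update n (c :: x)) b
    set d := decide (φ.Sat w Q (update (fun _ => []) n (c :: x))) with hd
    set S' := update S .new ((c, d) :: S .new) with hS'
    obtain ⟨b', h'⟩ := ih (by omega) S' ⟨by simp [hS', hS.word], by simp [hS', hS.var],
      by simp [hS', hS.tmp], by simp [hS', hS.left], by simp [hS', hS.right]⟩ d
    have hm : ∀ f : Symbol × Bool → Symbol × Bool, f (c, decide (Q (c :: x))) = (c, d) →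
        Exec (mv (.var n) f [.new]) (update (update S (.var n) (annotate Q (c :: x))) .res (flag d))
          1 (update (update S' (.var n) (annotate Q x)) .res (flag d)) := by
      intro f hf
      refine (Exec.mv _ _ _ _).of_eq ?_ le_rfl
      have e : update (update S (.var n) (annotate Q (c :: x))) .res (flag d) (.var n) =
        (c, decide (Q (c :: x))) :: annotate Q x := by simp [annotate]
      simp only [mvState, e, pushAll, hf]
      funext r
      cases r <;> simp [hS', update_apply]
      split_ifs <;> rfl
    have hi : Exec (ite .res Option.isSome (mv (.var n) (fun c => (c.1, true)) [.new])
        (mv (.var n) (fun c => (c.1, false)) [.new]))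
        (update (update S (.var n) (annotate Q (c :: x))) .res (flag d)) 2
        (update (update S' (.var n) (annotate Q x)) .res (flag d)) := by
      cases hdv : d
      · rw [hdv] at hm
        exact Exec.ite_false (by simp [flag]) (hm _ rfl)
      · rw [hdv] at hm
        exact Exec.ite_true (by simp [flag]) (hm _ rfl)
    refine ⟨b', (Exec.loop_true (by simp [annotate]) (h.seq hi) h').of_eq ?_ ?_⟩
    · simp only [hS', update_self, update_idem, annotate, List.reverse_cons, List.append_assoc,
        List.singleton_append, hd]
      congr 6
    · rw [List.length_cons]
      nlinarith

/-- A bound for the running time of `relabel`. -/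
noncomputable def relabelTime (φ : Fm m) : Polynomial ℕ :=
  Polynomial.X * (φ.time + 3) + 8 * Polynomial.X + 5

lemma exec_relabel {n : Fin m} {φ : Fm m} (hφ : φ.WF) (hn : n ∉ φ.bv) {w : List Symbol}
    {Q : List Symbol → Prop} {N : ℕ} (hN : w.length ≤ N)
    (S : Reg m → List (Symbol × Bool)) (hS : Holds S w Q fun _ => []) (hnew : S .new = [])
    (b : Bool) :
    ∃ b', Exec (relabel n φ) (update S .res (flag b)) (φ.relabelTime.eval N)
      (update (update S .word (annotate (next n φ w Q) w)) .res (flag b')) := by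
  have hSn : S (.var n) = [] := by simp [hS.var, annotate]
  have h₁ : Exec (copy .word (.var n) .tmp) (update S .res (flag b)) (4 * N + 2)
      (update (update S (.var n) (annotate Q w)) .res (flag b)) := by
    refine (exec_copy (by simp) (by simp) (by simp) _ (by simp [hSn]) (by simp [hS.tmp])).of_eq
      ?_ ?_
    · rw [update_comm (by simp)]; simp [hS.word]
    · simp [hS.word, hN]
  obtain ⟨b', h₂⟩ := exec_relabelLoop hφ hn hN w hN S hS b
  refine ⟨b', (h₁.seq (h₂.seq ((exec_clear _ _).seq (exec_move (by simp) id _)))).of_eq ?_ ?_⟩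
  · funext r
    cases r <;> simp [hnew]
  · simp only [relabelTime, Polynomial.eval_add, Polynomial.eval_mul, Polynomial.eval_X,
      Polynomial.eval_ofNat]
    have := Nat.mul_le_mul_right (φ.time.eval N + 3) hN
    simp [hnew, hS.word]
    linarith

/-- Starting with the empty predicate, apply `next n φ` as often as the word has letters, then
evaluate `ψ`, with the word as the value of the variable `n`. -/
def decider (n : Fin m) (φ ψ : Fm m) : Prog (Reg m) (Symbol × Bool) :=
  seq (move .left id .word) (seq (copy .word .ctr .tmp)
    (seq (loop .ctr Option.isSome (seq (relabel n φ) (mv .ctr id [])))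
      (seq (copy .word (.var n) .tmp) (seq (comp ψ) (seq (clear (.var n)) (clear .word))))))

/-- The state with the word `w`, annotated by `Q`, and the counter `l`. -/
noncomputable def wordState (w : List Symbol) (Q : List Symbol → Prop) (l : List (Symbol × Bool)) :
    Reg m → List (Symbol × Bool) :=
  update (update (fun _ => []) .word (annotate Q w)) .ctr l

lemma holds_wordState (w : List Symbol) (Q : List Symbol → Prop) (l : List (Symbol × Bool)) :
    Holds (wordState (m := m) w Q l) w Q fun _ => [] := by
  constructor <;> simp [wordState, annotate]

/-- The stack `ctr` is a unary counter that loses one entry per round, so its height is the exponent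
of the iterate. -/
lemma exec_deciderLoop {n : Fin m} {φ : Fm m} (hφ : φ.WF) (hn : n ∉ φ.bv) (w : List Symbol)
    (l : List (Symbol × Bool)) (Q : List Symbol → Prop) (b : Bool) :
    ∃ b', Exec (loop .ctr Option.isSome (seq (relabel n φ) (mv .ctr id [])))
      (update (wordState w Q l) .res (flag b))
      (l.length * (φ.relabelTime.eval w.length + 2) + 1)
      (update (wordState w ((next n φ w)^[l.length] Q) []) .res (flag b')) := by
  induction l generalizing Q b with
  | nil => exact ⟨b, (Exec.loop_false (by simp [wordState])).of_eq rfl (by simp)⟩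
  | cons c l ih =>
    obtain ⟨b₁, h₁⟩ := exec_relabel hφ hn le_rfl _ (holds_wordState w Q (c :: l))
      (by simp [wordState]) b
    have e : update (update (wordState (m := m) w Q (c :: l)) .word
        (annotate (next n φ w Q) w)) .res (flag b₁) =
        update (wordState w (next n φ w Q) (c :: l)) .res (flag b₁) := by
      funext r; cases r <;> simp [wordState]
    rw [e] at h₁
    have h₂ := exec_pop .ctr id (update (wordState (m := m) w (next n φ w Q) (c :: l)) .res
      (flag b₁))
    have e : update (update (wordState (m := m) w (next n φ w Q) (c :: l)) .res (flag b₁)) .ctr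
        (update (wordState (m := m) w (next n φ w Q) (c :: l)) .res (flag b₁) .ctr).tail =
        update (wordState w (next n φ w Q) l) .res (flag b₁) := by
      funext r; cases r <;> simp [wordState]
    rw [e] at h₂
    obtain ⟨b', h₃⟩ := ih (next n φ w Q) b₁
    refine ⟨b', (Exec.loop_true (by simp [wordState]) (h₁.seq h₂) h₃).of_eq rfl ?_⟩
    rw [List.length_cons]
    nlinarith

/-- A bound for the running time of `decider`. -/
noncomputable def deciderTime (φ ψ : Fm m) : Polynomial ℕ :=
  Polynomial.X * (φ.relabelTime + 2) + ψ.time + 14 * Polynomial.X + 20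

open Classical in
lemma exec_decider {n : Fin m} {φ ψ : Fm m} (hφ : φ.WF) (hn : n ∉ φ.bv) (hψ : ψ.WF)
    (hn' : n ∉ ψ.bv) (w : List Symbol) :
    Exec (decider n φ ψ) (update (fun _ => []) .left (w.map fun c => (c, false)).reverse)
      ((deciderTime φ ψ).eval w.length)
      (update (fun _ => []) .res (flag (decide
        (next n ψ w ((next n φ w)^[w.length] fun _ => False) w)))) := by
  have e : ∀ w : List Symbol, w.map (fun c => (c, false)) = annotate (fun _ => False) w := by
    intro w
    induction w with
    | nil => rfl
    | cons c w ih => simp [annotate, ih]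
  -- The machine delivers its input in reverse order, which `move` undoes; the initial labels
  -- `false` are the annotation by the empty predicate.
  have h₁ : Exec (move .left id .word)
      (update (fun _ => []) .left (w.map fun c => (c, false)).reverse) (2 * w.length + 1)
      (wordState (m := m) w (fun _ => False) []) := by
    refine (exec_move (by simp) id _).of_eq ?_ (by simp)
    funext r; cases r <;> simp [wordState, e]
  have h₂ : Exec (copy .word .ctr .tmp) (wordState (m := m) w (fun _ => False) [])
      (4 * w.length + 2) (update (wordState (m := m) w (fun _ => False)
        (annotate (fun _ => False) w)) .res (flag false)) := by
    refine (exec_copy (by simp) (by simp) (by simp) _ (by simp [wordState])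
      (by simp [wordState])).of_eq ?_ (by simp [wordState])
    funext r; cases r <;> simp [wordState, flag]
  obtain ⟨b, h₃⟩ := exec_deciderLoop hφ hn w (annotate (fun _ => False) w) (fun _ => False) false
  rw [length_annotate] at h₃
  set Q := (next n φ w)^[w.length] fun _ => False
  have h₄ : Exec (copy .word (.var n) .tmp) (update (wordState (m := m) w Q []) .res (flag b))
      (4 * w.length + 2)
      (update (update (wordState (m := m) w Q []) (.var n) (annotate Q w)) .res (flag b)) := by
    refine (exec_copy (by simp) (by simp) (by simp) _ (by simp [wordState])
      (by simp [wordState])).of_eq ?_ (by simp [wordState])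
    rw [update_comm (by simp)]; simp [wordState]
  have h₅ := exec_comp ψ w Q w.length le_rfl hψ (update (fun _ => []) n w)
      (fun i => by by_cases hi : i = n <;> simp [hi])
      (fun i hi => by rw [update_of_ne (ne_of_mem_of_not_mem hi hn')]) _
      ((holds_wordState w Q []).update n w) b
  refine (h₁.seq (h₂.seq (h₃.seq (h₄.seq (h₅.seq ((exec_clear _ _).seq
    (exec_clear _ _))))))).of_eq ?_ ?_
  · funext r
    cases r <;> simp [wordState, update_apply]
    · exact fun h h' => absurd h' h
    · exact congrArg flag (decide_eq_decide.2 Iff.rfl)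
  · simp only [deciderTime, Polynomial.eval_add, Polynomial.eval_mul, Polynomial.eval_X,
      Polynomial.eval_ofNat]
    simp [wordState]
    linarith

/-- A language is in P if it is defined by a formula about an iterated predicate. -/
theorem inP_of_fm {L : Language Symbol} {n : Fin m} {φ ψ : Fm m} (hφ : φ.WF) (hn : n ∉ φ.bv)
    (hψ : ψ.WF) (hn' : n ∉ ψ.bv)
    (hL : ∀ w, w ∈ L ↔ next n ψ w ((next n φ w)^[w.length] fun _ => False) w) : InP L := by
  classical
  have : Inhabited (Symbol × Bool) := ⟨(.sentence, false)⟩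
  exact inP_of_exec L (fun w => decide (next n ψ w ((next n φ w)^[w.length] fun _ => False) w))
    (fun w => by simp [hL]) (decider n φ ψ) (fun c => (c, false)) .left .res (.sentence, false)
    (deciderTime φ ψ) (fun w => exec_decider hφ hn hψ hn' w)

end Fm

end ABA

/-! ### Words as sequences of fields -/

namespace ABA

open Function

/-- The bits at the beginning of a word. -/
def readBits : List Symbol → List Bool
  | .bit b :: x => b :: readBits x
  | _ => []

lemma map_readBits (x : List Symbol) :
    (readBits x).map Symbol.bit = x.takeWhile Symbol.isBit := by
  induction x with
  | nil => rfl
  | cons c x ih => cases c <;> simp [readBits, List.takeWhile_cons, Symbol.isBit, ih]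

/-- The sentence in the first field of a word. -/
def fieldWord (x : List Symbol) : List Bool :=
  readBits x.tail

lemma fieldBits_eq_iff (x y : List Symbol) :
    fieldBits x = fieldBits y ↔ fieldWord x = fieldWord y := by
  rw [fieldBits, fieldBits, ← map_readBits, ← map_readBits]
  exact (List.map_injective_iff.2 fun a b h => by simpa using h).eq_iff

/-- The word is empty or starts with a mark. -/
def Marked (x : List Symbol) : Prop :=
  x.head?.any Symbol.isBit = false

lemma readBits_eq_nil {x : List Symbol} (hx : Marked x) : readBits x = [] := by
  rcases x with _ | ⟨_ | _, x⟩ <;> simp_all [Marked, readBits, Symbol.isBit]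

section field

variable (t : Symbol) (s : List Bool) {x : List Symbol}

lemma fieldWord_field (hx : Marked x) : fieldWord (field t s ++ x) = s := by
  simp only [fieldWord, field, List.cons_append, List.tail_cons]
  induction s with
  | nil => exact readBits_eq_nil hx
  | cons b s ih => simp [readBits, ih]

lemma nextField_field (hx : Marked x) : nextField (field t s ++ x) = x := by
  simp only [nextField, field, List.cons_append, List.tail_cons]
  induction s with
  | nil =>
    rcases x with _ | ⟨c, x⟩
    · rfl
    · have : c.isBit = false := by simpa [Marked] using hx
      simp [this]
  | cons b s ih =>
    rw [List.map_cons, List.cons_append, List.dropWhile_cons_of_pos rfl]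
    exact ih

lemma marked_field (ht : t.isBit = false) : Marked (field t s ++ x) := by
  simpa [Marked, field] using ht

end field

lemma marked_nextField (x : List Symbol) : Marked (nextField x) := by
  unfold Marked nextField
  induction x.tail with
  | nil => rfl
  | cons c x ih => cases h : c.isBit <;> simp [h, ih]

lemma cons_eq_field (c : Symbol) (x : List Symbol) :
    c :: x = field c (fieldWord (c :: x)) ++ nextField (c :: x) := by
  simp [field, fieldWord, nextField, map_readBits]

lemma length_nextField_lt (c : Symbol) (x : List Symbol) :
    (nextField (c :: x)).length < (c :: x).length := by
  rw [List.length_cons]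
  exact Nat.lt_succ_of_le (List.length_dropWhile_le _ _)

/-- A suffix that starts with a mark cannot start among the bits of a field. -/
lemma suffix_field_iff {t : Symbol} {s : List Bool} {w x : List Symbol} {u : Symbol}
    (hx : x.head? = some u) (hu : u.isBit = false) :
    x <:+ field t s ++ w ↔ x = field t s ++ w ∨ x <:+ w := by
  have hs : x <:+ s.map Symbol.bit ++ w ↔ x <:+ w := by
    induction s with
    | nil => rfl
    | cons b s ih =>
      rw [List.map_cons, List.cons_append, List.suffix_cons_iff, ih]
      refine or_iff_right fun h => ?_
      subst h
      simp only [List.head?_cons, Option.some.injEq] at hx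
      simp [← hx, Symbol.isBit] at hu
  exact List.suffix_cons_iff.trans (or_congr_right hs)

/-- Some field with mark `t` satisfies, together with the following field, the condition `P`. -/
def Occurs (w : List Symbol) (t : Symbol) (P : List Bool → List Bool → Prop) : Prop :=
  ∃ x, x <:+ w ∧ x.head? = some t ∧ P (fieldWord x) (fieldWord (nextField x))

section Occurs

variable {w : List Symbol} {t u : Symbol} {P : List Bool → List Bool → Prop}

lemma not_occurs_nil : ¬ Occurs [] u P := by
  rintro ⟨x, hx, h, -⟩
  simp_all

lemma occurs_field (s : List Bool) (hu : u.isBit = false) (hw : Marked w) :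
    Occurs (field t s ++ w) u P ↔ (u = t ∧ P s (fieldWord w)) ∨ Occurs w u P := by
  constructor
  · rintro ⟨x, hx, hxu, h⟩
    rcases (suffix_field_iff hxu hu).1 hx with rfl | hx
    · rw [fieldWord_field t s hw, nextField_field t s hw] at h
      exact .inl ⟨Option.some.inj hxu.symm, h⟩
    · exact .inr ⟨x, hx, hxu, h⟩
  · rintro (⟨rfl, h⟩ | ⟨x, hx, hxu, h⟩)
    · refine ⟨_, List.suffix_refl _, rfl, ?_⟩
      rwa [fieldWord_field u s hw, nextField_field u s hw]
    · exact ⟨x, hx.trans (List.suffix_append _ _), hxu, h⟩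

lemma marked_flatMap {γ : Type} {f : γ → List Symbol} (hf : ∀ c x, Marked (f c ++ x))
    (l : List γ) (hw : Marked w) : Marked (l.flatMap f ++ w) := by
  cases l with
  | nil => exact hw
  | cons c l => rw [List.flatMap_cons, List.append_assoc]; exact hf _ _

/-- The condition must ignore the following field, which for a list of single fields belongs to the
next item or to the next list. -/
lemma occurs_fields (l : List (List Bool)) (hu : u.isBit = false) (ht : t.isBit = false)
    (p : List Bool → Prop) (hw : Marked w) :
    Occurs (l.flatMap (field t) ++ w) u (fun s _ => p s) ↔
      (u = t ∧ ∃ s ∈ l, p s) ∨ Occurs w u fun s _ => p s := by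
  induction l with
  | nil => simp
  | cons s l ih =>
    rw [List.flatMap_cons, List.append_assoc, occurs_field s hu
      (marked_flatMap (fun c x => marked_field t c ht) l hw), ih]
    rw [List.exists_mem_cons_iff, and_or_left, or_assoc]

lemma occurs_fields_of_ne (l : List (List Bool)) (hu : u.isBit = false) (ht : t.isBit = false)
    (hut : u ≠ t) (hw : Marked w) :
    Occurs (l.flatMap (field t) ++ w) u P ↔ Occurs w u P := by
  induction l with
  | nil => simp
  | cons s l ih =>
    rw [List.flatMap_cons, List.append_assoc, occurs_field s hu
      (marked_flatMap (fun c x => marked_field t c ht) l hw), ih]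
    simp [hut]

/-- Two fields. -/
def twoFields (t t' : Symbol) (p : List Bool × List Bool) : List Symbol :=
  field t p.1 ++ field t' p.2

lemma marked_twoFields {t t' : Symbol} (ht : t.isBit = false) (p : List Bool × List Bool)
    (x : List Symbol) : Marked (twoFields t t' p ++ x) := by
  rw [twoFields, List.append_assoc]
  exact marked_field t p.1 ht

/-- The field after a first component is its second component, so `P` sees the pair. The assumption
`u ≠ t'` excludes occurrences at second components. -/
lemma occurs_twoFields {t' : Symbol} (l : List (List Bool × List Bool)) (hu : u.isBit = false)
    (ht : t.isBit = false) (ht' : t'.isBit = false) (hut : u ≠ t') (hw : Marked w) :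
    Occurs (l.flatMap (twoFields t t') ++ w) u P ↔
      (u = t ∧ ∃ p ∈ l, P p.1 p.2) ∨ Occurs w u P := by
  induction l with
  | nil => simp
  | cons p l ih =>
    have hm := marked_flatMap (fun c x => marked_twoFields (t' := t') ht c x) l hw
    rw [List.flatMap_cons, List.append_assoc, twoFields, List.append_assoc,
      occurs_field _ hu (marked_field _ _ ht'), occurs_field _ hu hm, ih,
      fieldWord_field t' _ hm]
    simp only [List.exists_mem_cons_iff, and_or_left, or_assoc, hut, false_and, false_or]

end Occurs

/-- The encoding of lists of sentences, assumptions with contraries, rules with one sentence in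
the body, and members of a set. -/
def encodeLists (ss : List (List Bool)) (ps rs : List (List Bool × List Bool))
    (ms : List (List Bool)) : List Symbol :=
  ss.flatMap (field .sentence) ++ (ps.flatMap (twoFields .assumption .contrary) ++
    (rs.flatMap (twoFields .head .body) ++ ms.flatMap (field .member)))

section encodeLists

variable (ss : List (List Bool)) (ps rs : List (List Bool × List Bool)) (ms : List (List Bool))

lemma marked_members : Marked (ms.flatMap (field .member)) := by
  simpa using marked_flatMap (w := []) (fun c x => marked_field .member c rfl) ms rfl

lemma marked_rules : Marked (rs.flatMap (twoFields .head .body) ++ ms.flatMap (field .member)) :=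
  marked_flatMap (fun c x => marked_twoFields rfl c x) rs (marked_members ms)

lemma marked_assumptions : Marked (ps.flatMap (twoFields .assumption .contrary) ++
    (rs.flatMap (twoFields .head .body) ++ ms.flatMap (field .member))) :=
  marked_flatMap (fun c x => marked_twoFields rfl c x) ps (marked_rules rs ms)

lemma occurs_encodeLists_sentence (p : List Bool → Prop) :
    Occurs (encodeLists ss ps rs ms) .sentence (fun s _ => p s) ↔ ∃ s ∈ ss, p s := by
  have h := occurs_fields_of_ne (w := []) (u := .sentence) (t := .member)
    (P := fun s _ => p s) ms rfl rfl (by simp) rfl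
  rw [List.append_nil] at h
  rw [encodeLists, occurs_fields ss rfl rfl p (marked_assumptions ps rs ms),
    occurs_twoFields ps rfl rfl rfl (by simp) (marked_rules rs ms),
    occurs_twoFields rs rfl rfl rfl (by simp) (marked_members ms), h]
  simp [not_occurs_nil]

lemma occurs_encodeLists_assumption (P : List Bool → List Bool → Prop) :
    Occurs (encodeLists ss ps rs ms) .assumption P ↔ ∃ p ∈ ps, P p.1 p.2 := by
  have h := occurs_fields_of_ne (w := []) (u := .assumption) (t := .member) (P := P)
    ms rfl rfl (by simp) rfl
  rw [List.append_nil] at h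
  rw [encodeLists, occurs_fields_of_ne ss rfl rfl (by simp) (marked_assumptions ps rs ms),
    occurs_twoFields ps rfl rfl rfl (by simp) (marked_rules rs ms),
    occurs_twoFields rs rfl rfl rfl (by simp) (marked_members ms), h]
  simp [not_occurs_nil]

lemma occurs_encodeLists_head (P : List Bool → List Bool → Prop) :
    Occurs (encodeLists ss ps rs ms) .head P ↔ ∃ p ∈ rs, P p.1 p.2 := by
  have h := occurs_fields_of_ne (w := []) (u := .head) (t := .member) (P := P)
    ms rfl rfl (by simp) rfl
  rw [List.append_nil] at h
  rw [encodeLists, occurs_fields_of_ne ss rfl rfl (by simp) (marked_assumptions ps rs ms),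
    occurs_twoFields ps rfl rfl rfl (by simp) (marked_rules rs ms),
    occurs_twoFields rs rfl rfl rfl (by simp) (marked_members ms), h]
  simp [not_occurs_nil]

lemma occurs_encodeLists_member (p : List Bool → Prop) :
    Occurs (encodeLists ss ps rs ms) .member (fun s _ => p s) ↔ ∃ s ∈ ms, p s := by
  have h := occurs_fields (w := []) (u := .member) (t := .member) ms rfl rfl p rfl
  rw [List.append_nil] at h
  rw [encodeLists, occurs_fields_of_ne ss rfl rfl (by simp) (marked_assumptions ps rs ms),
    occurs_twoFields ps rfl rfl rfl (by simp) (marked_rules rs ms),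
    occurs_twoFields rs rfl rfl rfl (by simp) (marked_members ms), h]
  simp [not_occurs_nil]

end encodeLists

/-! ### Well-formedness as a local condition on consecutive marks -/

/-- The marks that may follow a field with mark `t`. -/
def follows : Symbol → Option Symbol → Bool
  | .bit _, _ => true
  | .sentence, o => o ∈ [none, some .sentence, some .assumption, some .head, some .member]
  | .assumption, o => o = some .contrary
  | .contrary, o => o ∈ [none, some .assumption, some .head, some .member]
  | .head, o => o = some .body
  | .body, o => o ∈ [none, some .head, some .member]
  | .member, o => o ∈ [none, some .member]

section WellFormed

variable {w x : List Symbol} {t : Symbol}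

/-- The marks follow each other as in an encoding, except at the beginning. -/
def Chained (w : List Symbol) : Prop :=
  ∀ t x, x <:+ w → x.head? = some t → follows t (nextField x).head? = true

/-- The marks follow each other as in an encoding. -/
def WellFormed (w : List Symbol) : Prop :=
  follows .sentence w.head? = true ∧ Chained w

lemma chained_nil : Chained [] := by
  intro t x hx h
  simp_all

lemma chained_field (s : List Bool) (hx : Marked x) :
    Chained (field t s ++ x) ↔ follows t x.head? = true ∧ Chained x := by
  constructor
  · intro h
    refine ⟨?_, fun u y hy => h u y (hy.trans (List.suffix_append _ _))⟩
    have := h t _ (List.suffix_refl _) rfl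
    rwa [nextField_field t s hx] at this
  · rintro ⟨h, h'⟩ u y hy hyu
    by_cases hu : u.isBit
    · cases u <;> simp_all [Symbol.isBit, follows]
    · rcases (suffix_field_iff hyu (by simpa using hu)).1 hy with rfl | hy
      · rw [nextField_field t s hx]
        rwa [← (Option.some.inj hyu : t = u)]
      · exact h' u y hy hyu

lemma exists_of_chained_members (w : List Symbol) (hw : Chained w)
    (h : follows .member w.head? = true) : ∃ ms : List _, w = ms.flatMap (field .member) := by
  induction hn : w.length using Nat.strong_induction_on generalizing w with
  | _ n ih =>
  subst hn
  rcases w with _ | ⟨c, w⟩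
  · exact ⟨[], rfl⟩
  · have e := cons_eq_field c w
    obtain rfl : c = .member := by simpa [follows] using h
    rw [e, chained_field _ (marked_nextField _)] at hw
    obtain ⟨ms, hms⟩ := ih _ (length_nextField_lt _ _) _ hw.2 hw.1 rfl
    exact ⟨fieldWord (.member :: w) :: ms, by rw [List.flatMap_cons, ← hms, ← e]⟩

/-- Pairs are split off from the left until the word satisfies the exit condition `p` on its first
mark; the length decreases with every field. -/
lemma exists_of_chained_twoFields {u v : Symbol} (hu : u.isBit = false) (hv : v.isBit = false)
    (huv : ∀ o, follows u o = true → o = some v) (p : Option Symbol → Prop)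
    (hvo : ∀ o, follows v o = true → o = some u ∨ p o) (w : List Symbol)
    (hw : Chained w) (h : w.head? = some u ∨ p w.head?) :
    ∃ (l : List (List Bool × List Bool)) (w' : List Symbol),
      w = l.flatMap (twoFields u v) ++ w' ∧ Chained w' ∧ p w'.head? := by
  induction hn : w.length using Nat.strong_induction_on generalizing w with
  | _ n ih =>
  subst hn
  by_cases hp : p w.head?
  · exact ⟨[], w, rfl, hw, hp⟩
  rcases w with _ | ⟨c, w⟩
  · simp_all
  obtain rfl : c = u := by simpa using h.resolve_right hp
  have e := cons_eq_field c w
  rw [e, chained_field _ (marked_nextField _)] at hw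
  have hl : (nextField (c :: w)).length < (c :: w).length := length_nextField_lt _ _
  generalize nextField (c :: w) = y at hl e hw
  rcases y with _ | ⟨d, y⟩
  · simpa using huv _ hw.1
  obtain rfl : d = v := by simpa using huv _ hw.1
  have e' := cons_eq_field d y
  have hw' := hw.2
  rw [e', chained_field _ (marked_nextField _)] at hw'
  have hl' : (nextField (d :: y)).length < (d :: y).length :=
    length_nextField_lt _ _
  obtain ⟨l, w', hw₁, hw₂⟩ := ih _ (hl'.trans hl) _ hw'.2 (hvo _ hw'.1) rfl
  refine ⟨(fieldWord (c :: w), fieldWord (d :: y)) :: l, w', ?_, hw₂⟩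
  rw [List.flatMap_cons, List.append_assoc, ← hw₁, twoFields, List.append_assoc, ← e', ← e]

lemma exists_of_chained_sentences (w : List Symbol) (hw : Chained w)
    (h : follows .sentence w.head? = true) :
    ∃ (ss : List (List Bool)) (w' : List Symbol), w = ss.flatMap (field .sentence) ++ w' ∧
      Chained w' ∧ follows .contrary w'.head? = true := by
  induction hn : w.length using Nat.strong_induction_on generalizing w with
  | _ n ih =>
  subst hn
  by_cases hp : follows .contrary w.head? = true
  · exact ⟨[], w, rfl, hw, hp⟩
  rcases w with _ | ⟨c, w⟩
  · simp [follows] at hp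
  obtain rfl : c = .sentence := by cases c <;> simp_all [follows]
  have e := cons_eq_field .sentence w
  rw [e, chained_field _ (marked_nextField _)] at hw
  obtain ⟨ss, w', hw₁, hw₂⟩ := ih _ (length_nextField_lt _ _) _ hw.2 hw.1 rfl
  refine ⟨fieldWord (.sentence :: w) :: ss, w', ?_, hw₂⟩
  rw [List.flatMap_cons, List.append_assoc, ← hw₁, ← e]

lemma chained_fields (l : List (List Bool)) (ht : t.isBit = false)
    (htt : follows t (some t) = true) (hw : Chained w) (hm : Marked w)
    (h : follows t w.head? = true) :
    Chained (l.flatMap (field t) ++ w) ∧ follows t (l.flatMap (field t) ++ w).head? = true := by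
  induction l with
  | nil => exact ⟨hw, h⟩
  | cons s l ih =>
    rw [List.flatMap_cons, List.append_assoc, chained_field _
      (marked_flatMap (fun c x => marked_field t c ht) l hm)]
    exact ⟨⟨ih.2, ih.1⟩, htt⟩

lemma chained_twoFields {u v : Symbol} (l : List (List Bool × List Bool)) (hu : u.isBit = false)
    (hv : v.isBit = false) (huv : follows u (some v) = true) (hvu : follows v (some u) = true)
    (hw : Chained w) (hm : Marked w) (h : follows v w.head? = true) :
    Chained (l.flatMap (twoFields u v) ++ w) ∧
      follows v (l.flatMap (twoFields u v) ++ w).head? = true := by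
  induction l with
  | nil => exact ⟨hw, h⟩
  | cons s l ih =>
    have hm' := marked_flatMap (fun c x => marked_twoFields (t' := v) hu c x) l hm
    rw [List.flatMap_cons, List.append_assoc, twoFields, List.append_assoc, chained_field _
      (marked_field v _ hv), chained_field _ hm']
    exact ⟨⟨huv, ih.2, ih.1⟩, hvu⟩

/-- The order of the four lists is a regular condition, so it can be tested on consecutive marks.
The start of the word is treated like the end of a sentence field, which allows an empty list of
sentences. In the forward direction the lists are split off in turn, the exit condition of each
being the entry condition of the next. -/
theorem wellFormed_iff (w : List Symbol) :
    WellFormed w ↔ ∃ ss ps rs ms, w = encodeLists ss ps rs ms := by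
  constructor
  · rintro ⟨h, hw⟩
    obtain ⟨ss, w₁, rfl, hw₁, h₁⟩ := exists_of_chained_sentences w hw h
    -- What may follow the assumptions is what may follow a rule, because the list of rules may be
    -- empty.
    obtain ⟨ps, w₂, rfl, hw₂, h₂⟩ := exists_of_chained_twoFields (u := .assumption)
      (v := .contrary) rfl rfl (by simp [follows]) (fun o => follows .body o = true)
      (by simp [follows]) w₁ hw₁ (by simp [follows] at h₁ ⊢; tauto)
    obtain ⟨rs, w₃, rfl, hw₃, h₃⟩ := exists_of_chained_twoFields (u := .head)
      (v := .body) rfl rfl (by simp [follows]) (fun o => follows .member o = true)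
      (by simp [follows]) w₂ hw₂ (by simp [follows] at h₂ ⊢; tauto)
    obtain ⟨ms, rfl⟩ := exists_of_chained_members w₃ hw₃ h₃
    exact ⟨ss, ps, rs, ms, rfl⟩
  · rintro ⟨ss, ps, rs, ms, rfl⟩
    have h₁ := chained_fields (w := []) (t := .member) ms rfl rfl chained_nil rfl rfl
    rw [List.append_nil] at h₁
    have h₂ := chained_twoFields (u := .head) (v := .body) rs rfl rfl rfl rfl h₁.1
      (marked_members ms) (by have := h₁.2; simp [follows] at this ⊢; tauto)
    have h₃ := chained_twoFields (u := .assumption) (v := .contrary) ps rfl rfl rfl rfl h₂.1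
      (marked_rules rs ms) (by have := h₂.2; simp [follows] at this ⊢; tauto)
    have h₄ := chained_fields (t := .sentence) ss rfl rfl h₃.1
      (marked_assumptions ps rs ms) (by have := h₃.2; simp [follows] at this ⊢; tauto)
    exact ⟨h₄.2, h₄.1⟩

end WellFormed

end ABA

/-! ### Set-stability in bipolar frameworks as reachability -/

namespace ABA

open Relation

namespace Framework

universe v

variable {S : Type v} (F : Framework S)

/-- There is a rule `y ← x`. -/
def Step (x y : S) : Prop :=
  ∃ r ∈ F.rules, r.body = [x] ∧ r.head = y

/-- `s` belongs to `A` or is the head of a rule with body in `A`. -/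
def Forces (A : Set S) (s : S) : Prop :=
  s ∈ A ∨ ∃ b ∈ A, F.Step b s

variable {F}

/-- With one entry in every body, a deduction tree has no branching: it is a path from its only leaf
to its root. -/
lemma derives_iff (hF : F.Bipolar) {A : Set S} (hA : A ⊆ F.assumptions) (s : S) :
    F.Derives A s ↔ ∃ a ∈ A, ReflTransGen F.Step a s := by
  constructor
  · rintro ⟨A', R, hA', -, h⟩
    induction h with
    | leaf a ha => exact ⟨a, hA' rfl, .refl⟩
    | node r hr B R h ih =>
      obtain ⟨⟨b, -, hb⟩, -⟩ := hF r hr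
      have hl : 0 < r.body.length := by simp [hb]
      obtain ⟨a, ha, hab⟩ := ih ⟨0, hl⟩ ((Set.subset_iUnion B _).trans hA')
      refine ⟨a, ha, hab.tail ⟨r, hr, ?_, rfl⟩⟩
      simp [hb]
  · rintro ⟨a, ha, h⟩
    induction h with
    | refl => exact ⟨{a}, ∅, by simpa using ha, by simp, .leaf a (hA ha)⟩
    | @tail x y _ hs ih =>
      obtain ⟨A', R, hA', hR, hd⟩ := ih
      obtain ⟨r, hr, hb, rfl⟩ := hs
      refine ⟨⋃ _ : Fin r.body.length, A', {r} ∪ ⋃ _ : Fin r.body.length, R,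
        Set.iUnion_subset fun _ => hA',
        Set.union_subset (Set.singleton_subset_iff.2 hr) (Set.iUnion_subset fun _ => hR),
        .node r hr _ _ fun i => ?_⟩
      rwa [(by simp [hb] : ∀ c ∈ r.body, c = x) _ (List.get_mem _ i)]

/-- A vertex with a further step after it is a rule body, hence an assumption, so closure under
single rules keeps it in `A`. Only the last step of a path can leave `A`. -/
lemma derives_iff_forces (hF : F.Bipolar) {A : Set S} (hA : A ⊆ F.assumptions)
    (hc : ∀ b ∈ A, ∀ h ∈ F.assumptions, F.Step b h → h ∈ A) (s : S) :
    F.Derives A s ↔ F.Forces A s := by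
  rw [derives_iff hF hA]
  constructor
  · rintro ⟨a, ha, h⟩
    induction h with
    | refl => exact .inl ha
    | @tail x y _ hs ih =>
      have hx : x ∈ F.assumptions := by
        obtain ⟨r, hr, hb, -⟩ := hs
        obtain ⟨⟨b, hb', hb''⟩, -⟩ := hF r hr
        rw [hb, List.cons.injEq] at hb''
        rwa [hb''.1]
      obtain hxA | ⟨b, hb, hbx⟩ := ih
      · exact .inr ⟨x, hxA, hs⟩
      · exact .inr ⟨x, hc b hb x hx hbx, hs⟩
  · rintro (h | ⟨b, hb, h⟩)
    · exact ⟨s, h, .refl⟩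
    · exact ⟨b, hb, .single h⟩

/-- In a bipolar framework, set-stability is a matter of single rule applications, except that an
assumption outside the set must lead to an attacked assumption. -/
theorem setStable_iff (hF : F.Bipolar) {A : Set S} (hA : A ⊆ F.assumptions) :
    F.SetStable A ↔ (∀ b ∈ A, ∀ h ∈ F.assumptions, F.Step b h → h ∈ A) ∧
      (∀ a : F.assumptions, a.1 ∈ A → ¬ F.Forces A (F.contrary a)) ∧
      ∀ a ∈ F.assumptions, a ∉ A →
        ∃ b : F.assumptions, ReflTransGen F.Step a b ∧ F.Forces A (F.contrary b) := by
  have hcl : F.IsClosed A ↔ ∀ b ∈ A, ∀ h ∈ F.assumptions, F.Step b h → h ∈ A := by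
    constructor
    · intro h b hb s hs hbs
      rw [h]
      exact ⟨hs, (derives_iff hF hA s).2 ⟨b, hb, .single hbs⟩⟩
    · intro h
      refine Set.Subset.antisymm (fun a ha => ⟨hA ha, (derives_iff hF hA a).2 ⟨a, ha, .refl⟩⟩) ?_
      rintro a ⟨ha, hd⟩
      obtain h' | ⟨b, hb, hba⟩ := (derives_iff_forces hF hA h a).1 hd
      · exact h'
      · exact h b hb a ha hba
  unfold SetStable ConflictFree Attacks
  rw [hcl]
  -- Derivability reduces to single rules only for closed `A`, so closedness is kept as the
  -- hypothesis `hc` for the other two conditions.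
  refine (and_iff_right hA).trans (and_congr_right fun hc => and_congr ?_ ?_)
  · simp only [derives_iff_forces hF hA hc, not_exists, not_and]
  · simp only [derives_iff_forces hF hA hc, cl, Set.mem_ofPred_eq, Set.mem_sdiff, and_imp]
    refine forall₃_congr fun a ha _ => exists_congr fun b => and_congr_left fun _ => ?_
    rw [derives_iff hF (Set.singleton_subset_iff.2 ha)]
    simp [b.2]

end Framework

/-- An increasing iteration of a function on sets that stays within a set with at most `N` elements
reaches a fixed point after `N` rounds. -/
lemma iterate_stabilizes {α : Type*} {f : Set α → Set α} (hf : Monotone f) {U : Set α}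
    (hU : U.Finite) (hfU : ∀ A, f A ⊆ U) {N : ℕ} (hN : U.ncard ≤ N) :
    f (f^[N] ∅) = f^[N] ∅ := by
  have hmono : ∀ t, f^[t] ∅ ⊆ f (f^[t] ∅) := by
    intro t
    induction t with
    | zero => exact Set.empty_subset _
    | succ t ih => rw [Function.iterate_succ_apply']; exact hf ih
  have hsub : ∀ t, f^[t] ∅ ⊆ U := fun t => (hmono t).trans (hfU _)
  -- Each round before stabilization adds at least one element.
  have h : ∀ t, t ≤ (f^[t] ∅).ncard ∨ f (f^[t] ∅) = f^[t] ∅ := by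
    intro t
    induction t with
    | zero => exact .inl (Nat.zero_le _)
    | succ t ih =>
      rw [Function.iterate_succ_apply']
      rcases eq_or_ne (f (f^[t] ∅)) (f^[t] ∅) with h | h
      · exact .inr (by rw [h, h])
      · refine .inl (Nat.succ_le_of_lt ((ih.resolve_right h).trans_lt ?_))
        exact Set.ncard_lt_ncard ((hmono t).ssubset_of_ne h.symm) (hU.subset (hfU _))
  rcases h N with h | h
  -- With `N` elements the iterate is all of `U`, and nothing is left to add.
  · have : f^[N] ∅ = U := Set.eq_of_subset_of_ncard_le (hsub N) (hN.trans h) hU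
    exact Set.Subset.antisymm (by rw [this]; exact hfU _) (hmono N)
  · exact h

end ABA

/-! ### The verification problem as a formula -/

namespace ABA

open Function Relation

/-- All fields with mark `t` satisfy, together with the following field, the condition `P`. -/
def Always (w : List Symbol) (t : Symbol) (P : List Bool → List Bool → Prop) : Prop :=
  ¬ Occurs w t fun s s' => ¬ P s s'

/-- `s` is listed with mark `t`. -/
def Listed (w : List Symbol) (t : Symbol) (s : List Bool) : Prop :=
  Occurs w t fun s' _ => s' = s

/-- `s` is listed as a member, or as the head of a rule whose body is listed as a member. -/
def ListedForces (w : List Symbol) (s : List Bool) : Prop :=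
  Listed w .member s ∨ Occurs w .head fun h b => h = s ∧ Listed w .member b

/-- The word lists a bipolar framework and a set of assumptions. -/
def Valid (w : List Symbol) : Prop :=
  Occurs w .assumption (fun _ _ => True) ∧
  Always w .assumption (fun a c => Listed w .sentence a ∧ Listed w .sentence c) ∧
  Always w .assumption (fun a c => Always w .assumption fun a' c' => a' = a → c' = c) ∧
  Always w .head (fun h b => Listed w .sentence h ∧ Listed w .assumption b ∧
    (Listed w .assumption h ∨ Occurs w .assumption fun _ c => c = h)) ∧
  Always w .member (fun s _ => Listed w .assumption s)

/-- The set listed in the word is closed and conflict-free, and every other assumption satisfies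
`Q`. -/
def Stable (w : List Symbol) (Q : List Symbol → Prop) : Prop :=
  Always w .head (fun h b => Listed w .member b → Listed w .assumption h → Listed w .member h) ∧
  Always w .assumption (fun a c => Listed w .member a → ¬ ListedForces w c) ∧
  ¬ ∃ x, x <:+ w ∧ x.head? = some .assumption ∧ ¬ (Listed w .member (fieldWord x) ∨ Q x)

namespace Fm

variable {m : ℕ}

/-- Disjunction. -/
def or (φ ψ : Fm m) : Fm m := neg (and (neg φ) (neg ψ))

/-- Implication. -/
def imp (φ ψ : Fm m) : Fm m := neg (and φ (neg ψ))

/-- Some suffix that starts with `t` satisfies `φ`. -/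
def exMark (t : Symbol) (n : Fin m) (φ : Fm m) : Fm m :=
  ex n (and (head (fun o => o = some t) n) φ)

/-- All suffixes that start with `t` satisfy `φ`. -/
def allMark (t : Symbol) (n : Fin m) (φ : Fm m) : Fm m := neg (exMark t n (neg φ))

/-- The first field of `y` is listed with mark `t`. -/
def listed (t : Symbol) (y n : Fin m) : Fm m := exMark t n (eqf n y)

/-- The formula for `ListedForces`. -/
def forces (y n n' n'' : Fin m) : Fm m :=
  or (listed .member y n) (exMark .head n (and (eqf n y) (nxt n' n (listed .member n' n''))))

section Sat

variable {w : List Symbol} {Q : List Symbol → Prop} {φ ψ : Fm m} {v : Fin m → List Symbol}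

lemma sat_or : Sat w Q (or φ ψ) v ↔ Sat w Q φ v ∨ Sat w Q ψ v := by
  simp only [or, Sat]; tauto

lemma sat_imp : Sat w Q (imp φ ψ) v ↔ (Sat w Q φ v → Sat w Q ψ v) := by
  simp only [imp, Sat]; tauto

lemma sat_exMark {t : Symbol} {n : Fin m} : Sat w Q (exMark t n φ) v ↔
    ∃ x, x <:+ w ∧ x.head? = some t ∧ Sat w Q φ (update v n x) := by
  simp only [exMark, Sat, update_self, decide_eq_true_eq]
  refine exists_congr fun x => and_congr_right fun _ => ⟨fun h => h.2, fun h => ⟨?_, h⟩⟩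
  rintro rfl
  simp at h

lemma sat_exMark_iff_occurs {t : Symbol} {n : Fin m} {P : List Bool → List Bool → Prop}
    (h : ∀ x, Sat w Q φ (update v n x) ↔ P (fieldWord x) (fieldWord (nextField x))) :
    Sat w Q (exMark t n φ) v ↔ Occurs w t P := by
  simp only [sat_exMark, h, Occurs]

lemma sat_allMark_iff_always {t : Symbol} {n : Fin m} {P : List Bool → List Bool → Prop}
    (h : ∀ x, Sat w Q φ (update v n x) ↔ P (fieldWord x) (fieldWord (nextField x))) :
    Sat w Q (allMark t n φ) v ↔ Always w t P :=
  not_congr (sat_exMark_iff_occurs fun x => not_congr (h x))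

lemma sat_eqf {x y : Fin m} : Sat w Q (eqf x y) v ↔ fieldWord (v x) = fieldWord (v y) :=
  fieldBits_eq_iff _ _

lemma sat_listed {t : Symbol} {y n : Fin m} (h : y ≠ n) :
    Sat w Q (listed t y n) v ↔ Listed w t (fieldWord (v y)) :=
  sat_exMark_iff_occurs fun x => by simp [sat_eqf, h]

lemma sat_forces {y n n' n'' : Fin m} (h : y ≠ n) (h' : n' ≠ n'') :
    Sat w Q (forces y n n' n'') v ↔ ListedForces w (fieldWord (v y)) := by
  rw [forces, sat_or, sat_listed h]
  refine or_congr_right (sat_exMark_iff_occurs fun x => ?_)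
  simp [Sat, fieldBits_eq_iff, h, sat_listed h']

end Sat

/-- The formula whose iteration yields the assumptions that lead to an attacked assumption. -/
def leads : Fm 6 :=
  and (head (fun o => o = some .assumption) 0)
    (or (nxt 1 0 (forces 1 2 3 4))
      (exMark .head 1 (nxt 2 1 (and (eqf 2 0) (exMark .assumption 3 (and (eqf 3 1) (ann 3)))))))

/-- The formula for `WellFormed`. -/
def wellFormed : Fm 6 :=
  and (head (follows .sentence) 0)
    (and (allMark .sentence 1 (nxt 2 1 (head (follows .sentence) 2)))
      (and (allMark .assumption 1 (nxt 2 1 (head (follows .assumption) 2)))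
        (and (allMark .contrary 1 (nxt 2 1 (head (follows .contrary) 2)))
          (and (allMark .head 1 (nxt 2 1 (head (follows .head) 2)))
            (and (allMark .body 1 (nxt 2 1 (head (follows .body) 2)))
              (allMark .member 1 (nxt 2 1 (head (follows .member) 2))))))))

/-- The formula for `Valid`. -/
def valid : Fm 6 :=
  and (exMark .assumption 1 (eqf 1 1))
    (and (allMark .assumption 1 (and (listed .sentence 1 2) (nxt 2 1 (listed .sentence 2 3))))
      (and (allMark .assumption 1 (allMark .assumption 2
          (imp (eqf 2 1) (nxt 3 1 (nxt 4 2 (eqf 4 3))))))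
        (and (allMark .head 1 (and (listed .sentence 1 2)
            (and (nxt 2 1 (listed .assumption 2 3))
              (or (listed .assumption 1 2) (exMark .assumption 2 (nxt 3 2 (eqf 3 1)))))))
          (allMark .member 1 (listed .assumption 1 2)))))

/-- The formula for `Stable`. -/
def stable : Fm 6 :=
  and (allMark .head 1 (imp (nxt 2 1 (listed .member 2 3))
      (imp (listed .assumption 1 2) (listed .member 1 2))))
    (and (allMark .assumption 1 (imp (listed .member 1 2) (neg (nxt 2 1 (forces 2 3 4 5)))))
      (allMark .assumption 1 (or (listed .member 1 2) (ann 1))))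

section

variable {w : List Symbol} {Q : List Symbol → Prop} {v : Fin 6 → List Symbol}

/-- This is a step of the backward search, on positions instead of sentences. Since `Q` lives on
positions, the head of a rule is looked up at a position `z` that lists it as an assumption. -/
lemma next_leads (x : List Symbol) : next 0 leads w Q x ↔ x.head? = some .assumption ∧
    (ListedForces w (fieldWord (nextField x)) ∨ Occurs w .head fun h b => b = fieldWord x ∧
      ∃ z, z <:+ w ∧ z.head? = some .assumption ∧ fieldWord z = h ∧ Q z) := by
  simp only [next, leads, Sat, update_self, decide_eq_true_eq, sat_or]
  rw [sat_forces (by decide) (by decide)]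
  refine and_congr_right fun _ => or_congr (by simp) (sat_exMark_iff_occurs fun y => ?_)
  simp only [Sat, fieldBits_eq_iff, sat_exMark]
  simp
  refine fun _ => exists_congr fun z => and_congr_right fun _ => and_congr_right fun h =>
    and_congr_right fun _ => and_iff_right ?_
  rintro rfl
  simp at h

lemma sat_wellFormed (h : v 0 = w) : Sat w Q wellFormed v ↔ WellFormed w := by
  have hs : ∀ t, Sat w Q (allMark t 1 (nxt 2 1 (head (follows t) 2))) v ↔
      ∀ x, x <:+ w → x.head? = some t → follows t (nextField x).head? = true := by
    intro t
    simp [allMark, Sat, sat_exMark]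
  simp only [wellFormed, Sat, h, WellFormed, Chained]
  refine and_congr_right fun _ => ?_
  simp only [hs]
  constructor
  -- Nothing is required after a bit, so the six marks suffice.
  · rintro ⟨h₁, h₂, h₃, h₄, h₅, h₆⟩ (b | _)
    · exact fun _ _ _ => rfl
    all_goals assumption
  · exact fun h => ⟨h _, h _, h _, h _, h _, h _⟩

lemma sat_valid : Sat w Q valid v ↔ Valid w := by
  refine and_congr ?_ (and_congr ?_ (and_congr ?_ (and_congr ?_ ?_)))
  · exact sat_exMark_iff_occurs fun x => by simp [sat_eqf]
  · exact sat_allMark_iff_always fun x => by simp [Sat, sat_listed]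
  · refine sat_allMark_iff_always fun x => sat_allMark_iff_always fun y => ?_
    simp [Sat, sat_imp, fieldBits_eq_iff]
  · refine sat_allMark_iff_always fun x => and_congr ?_ (and_congr ?_ ?_)
    · simp [sat_listed]
    · simp [Sat, sat_listed]
    · rw [sat_or]
      refine or_congr (by simp [sat_listed]) (sat_exMark_iff_occurs fun y => ?_)
      simp [Sat, fieldBits_eq_iff]
  · exact sat_allMark_iff_always fun x => by simp [sat_listed]

lemma sat_stable : Sat w Q stable v ↔ Stable w Q := by
  refine and_congr ?_ (and_congr ?_ (not_congr ?_))
  · exact sat_allMark_iff_always fun x => by simp [Sat, sat_imp, sat_listed]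
  · exact sat_allMark_iff_always fun x => by simp [Sat, sat_imp, sat_listed, sat_forces]
  · rw [sat_exMark]
    refine exists_congr fun x => and_congr_right fun _ => and_congr_right fun h => not_congr ?_
    have hx : x ≠ [] := by rintro rfl; simp at h
    simp [Sat, sat_or, sat_listed, hx]

end

end Fm

/-! ### Words and the frameworks that they encode -/

/-- The word lists the framework `F` and the set `A`. -/
structure Lists (w : List Symbol) (F : Framework (List Bool)) (A : Set (List Bool)) : Prop where
  sentence : ∀ p : List Bool → Prop, Occurs w .sentence (fun s _ => p s) ↔ ∃ s ∈ F.language, p s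
  assumption : ∀ P, Occurs w .assumption P ↔ ∃ a : F.assumptions, P a (F.contrary a)
  head : ∀ P, Occurs w .head P ↔ ∃ h b, ⟨h, [b]⟩ ∈ F.rules ∧ P h b
  member : ∀ p : List Bool → Prop, Occurs w .member (fun s _ => p s) ↔ ∃ s ∈ A, p s

section Lists

variable {w : List Symbol} {F : Framework (List Bool)} {A : Set (List Bool)}

lemma flatMap_encodeRule (l : List (List Bool × List Bool)) :
    (l.map fun p => (⟨p.1, [p.2]⟩ : Rule (List Bool))).flatMap encodeRule =
      l.flatMap (twoFields .head .body) := by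
  rw [List.flatMap_map]
  congr 1
  funext p
  simp [encodeRule, twoFields]

lemma encodeLists_eq (ss : List (List Bool)) (ps rs : List (List Bool × List Bool))
    (ms : List (List Bool)) : encodeLists ss ps rs ms = ss.flatMap (field Symbol.sentence) ++
      ps.flatMap encodeContrary ++
      (rs.map fun p => (⟨p.1, [p.2]⟩ : Rule (List Bool))).flatMap encodeRule ++
      ms.flatMap (field Symbol.member) := by
  rw [flatMap_encodeRule, List.append_assoc, List.append_assoc]
  rfl

lemma Encodes.wellFormed_and_lists (h : Encodes w F A) (hF : F.Bipolar) :
    WellFormed w ∧ Lists w F A := by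
  obtain ⟨ss, ps, rs, ms, hs, hp, hr, hm, rfl⟩ := h
  -- Bipolarity makes every body a singleton, so a rule is the pair of its head and its body entry;
  -- the default `[]` is never used.
  have e : (rs.map fun r => (r.head, r.body.headD [])).map
      (fun p => (⟨p.1, [p.2]⟩ : Rule (List Bool))) = rs := by
    rw [List.map_map]
    conv_rhs => rw [← List.map_id rs]
    refine List.map_congr_left fun r h => ?_
    obtain ⟨⟨b, -, hb⟩, -⟩ := hF r ((hr r).1 h)
    cases r
    simp_all
  rw [← e, ← encodeLists_eq]
  refine ⟨(wellFormed_iff _).2 ⟨_, _, _, _, rfl⟩, fun p => ?_, fun P => ?_, fun P => ?_,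
    fun p => ?_⟩
  · rw [occurs_encodeLists_sentence]; simp [hs]
  · rw [occurs_encodeLists_assumption]
    simp only [hp]
    exact ⟨fun ⟨p, ⟨a, h⟩, h'⟩ => ⟨a, by subst h; exact h'⟩, fun ⟨a, h⟩ => ⟨_, ⟨a, rfl⟩, h⟩⟩
  · rw [occurs_encodeLists_head]
    constructor
    · rintro ⟨p, hp, h⟩
      refine ⟨p.1, p.2, ?_, h⟩
      rw [← hr, ← e]
      exact List.mem_map_of_mem hp
    · rintro ⟨x, b, hx, h⟩
      rw [← hr] at hx
      exact ⟨_, List.mem_map_of_mem hx, h⟩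
  · rw [occurs_encodeLists_member]; simp [hm]

section

variable (ss : List (List Bool)) (ps rs : List (List Bool × List Bool)) (ms : List (List Bool))

lemma always_encodeLists_assumption (P : List Bool → List Bool → Prop) :
    Always (encodeLists ss ps rs ms) .assumption P ↔ ∀ p ∈ ps, P p.1 p.2 := by
  simp [Always, occurs_encodeLists_assumption]

lemma always_encodeLists_head (P : List Bool → List Bool → Prop) :
    Always (encodeLists ss ps rs ms) .head P ↔ ∀ p ∈ rs, P p.1 p.2 := by
  simp [Always, occurs_encodeLists_head]

lemma always_encodeLists_member (p : List Bool → Prop) :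
    Always (encodeLists ss ps rs ms) .member (fun s _ => p s) ↔ ∀ s ∈ ms, p s := by
  simp [Always, occurs_encodeLists_member]

end

/-- The clauses of `Valid` are what is needed to read a bipolar framework and a set of assumptions
off the four lists. Repeated entries are harmless. -/
lemma exists_encodes (hw : WellFormed w) (hv : Valid w) :
    ∃ (F : Framework (List Bool)) (A : Set (List Bool)), A ⊆ F.assumptions ∧ F.Bipolar ∧
      Encodes w F A := by
  obtain ⟨ss, ps, rs, ms, rfl⟩ := (wellFormed_iff w).1 hw
  obtain ⟨h₁, h₂, h₃, h₄, h₅⟩ := hv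
  simp only [Listed, always_encodeLists_assumption, always_encodeLists_head,
    always_encodeLists_member, occurs_encodeLists_sentence, occurs_encodeLists_assumption,
    exists_eq_right, and_true] at h₁ h₂ h₃ h₄ h₅
  have hc : ∀ a : {a | ∃ p ∈ ps, p.1 = a}, ∃ c, (a.1, c) ∈ ps := by
    rintro ⟨_, p, hp, rfl⟩
    exact ⟨p.2, hp⟩
  choose c hc using hc
  -- By the third clause of `Valid` all entries for one assumption carry the same contrary, so the
  -- chosen contrary is the listed one.
  have hc' : ∀ p (hp : p ∈ ps), c ⟨p.1, p, hp, rfl⟩ = p.2 := fun p hp =>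
    h₃ p hp _ (hc ⟨p.1, p, hp, rfl⟩) rfl
  let F : Framework (List Bool) :=
    { language := {s | s ∈ ss}
      rules := {r | r ∈ rs.map fun p => (⟨p.1, [p.2]⟩ : Rule (List Bool))}
      assumptions := {a | ∃ p ∈ ps, p.1 = a}
      contrary := c
      head_mem := by
        intro r hr
        obtain ⟨p, hp, rfl⟩ := List.mem_map.1 hr
        exact (h₄ p hp).1
      body_mem := by
        intro r hr s hs
        obtain ⟨p, hp, rfl⟩ := List.mem_map.1 hr
        obtain rfl := List.mem_singleton.1 hs
        obtain ⟨q, hq, hqp⟩ := (h₄ p hp).2.1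
        exact hqp ▸ (h₂ q hq).1
      assumptions_subset := by
        rintro _ ⟨p, hp, rfl⟩
        exact (h₂ p hp).1
      assumptions_nonempty := by
        obtain ⟨p, hp⟩ := h₁
        exact ⟨p.1, p, hp, rfl⟩
      contrary_mem := fun a => (h₂ _ (hc a)).2 }
  refine ⟨F, {s | s ∈ ms}, fun s hs => h₅ s hs, ?_, ss, ps,
    rs.map fun p => ⟨p.1, [p.2]⟩, ms, fun _ => Iff.rfl, ?_, fun _ => Iff.rfl, fun _ => Iff.rfl,
    encodeLists_eq ss ps rs ms⟩
  · intro r hr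
    obtain ⟨p, hp, rfl⟩ := List.mem_map.1 hr
    refine ⟨⟨p.2, (h₄ p hp).2.1, rfl⟩, (h₄ p hp).2.2.imp id ?_⟩
    rintro ⟨q, hq, hqp⟩
    exact ⟨⟨q.1, q, hq, rfl⟩, by rw [← hqp]; exact (hc' q hq).symm⟩
  · intro p
    constructor
    · exact fun hp => ⟨⟨p.1, p, hp, rfl⟩, Prod.ext rfl (hc' p hp).symm⟩
    · rintro ⟨a, rfl⟩
      exact hc a

namespace Lists

lemma always_assumption (h : Lists w F A) (P : List Bool → List Bool → Prop) :
    Always w .assumption P ↔ ∀ a : F.assumptions, P a (F.contrary a) := by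
  simp only [Always, h.assumption, not_exists, not_not]

lemma always_head (h : Lists w F A) (P : List Bool → List Bool → Prop) :
    Always w .head P ↔ ∀ x b, ⟨x, [b]⟩ ∈ F.rules → P x b := by
  simp [Always, h.head]

lemma always_member (h : Lists w F A) (p : List Bool → Prop) :
    Always w .member (fun s _ => p s) ↔ ∀ s ∈ A, p s := by
  simp [Always, h.member]

lemma listed_assumption (h : Lists w F A) (s : List Bool) :
    Listed w .assumption s ↔ s ∈ F.assumptions := by
  rw [Listed, h.assumption]; simp

lemma listed_member (h : Lists w F A) (s : List Bool) : Listed w .member s ↔ s ∈ A := by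
  rw [Listed, h.member]; simp

lemma listed_sentence (h : Lists w F A) (s : List Bool) :
    Listed w .sentence s ↔ s ∈ F.language := by
  rw [Listed, h.sentence]; simp

lemma step_iff (x y : List Bool) : F.Step x y ↔ ⟨y, [x]⟩ ∈ F.rules := by
  constructor
  · rintro ⟨⟨h, b⟩, hr, rfl, rfl⟩
    exact hr
  · exact fun h => ⟨_, h, rfl, rfl⟩

lemma listedForces (h : Lists w F A) (s : List Bool) : ListedForces w s ↔ F.Forces A s := by
  rw [ListedForces, Framework.Forces, h.listed_member, h.head]
  simp only [step_iff, h.listed_member]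
  exact or_congr_right ⟨fun ⟨_, b, hb, e, hA⟩ => ⟨b, hA, e ▸ hb⟩,
    fun ⟨b, hA, hb⟩ => ⟨s, b, hb, rfl, hA⟩⟩

lemma valid (h : Lists w F A) (hF : F.Bipolar) (hA : A ⊆ F.assumptions) : Valid w := by
  unfold Valid
  simp only [h.always_assumption, h.always_head, h.always_member, h.listed_assumption,
    h.listed_sentence, h.assumption]
  refine ⟨?_, fun a => ⟨F.assumptions_subset a.2, F.contrary_mem a⟩, ?_, ?_, fun a ha => hA ha⟩
  · obtain ⟨a, ha⟩ := F.assumptions_nonempty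
    exact ⟨⟨a, ha⟩, trivial⟩
  · exact fun a a' e => by rw [Subtype.ext e]
  · intro x b hx
    obtain ⟨⟨a, ha, e⟩, h'⟩ := hF _ hx
    obtain rfl : b = a := by simpa using e
    exact ⟨F.head_mem _ hx, ha, h'.imp id fun ⟨c, hc⟩ => ⟨c, hc.symm⟩⟩

lemma of_suffix (h : Lists w F A) {x : List Symbol} (hx : x <:+ w)
    (hx' : x.head? = some .assumption) :
    ∃ a : F.assumptions, fieldWord x = a ∧ fieldWord (nextField x) = F.contrary a := by
  obtain ⟨a, h₁, h₂⟩ := (h.assumption fun s s' => s = fieldWord x ∧ s' = fieldWord (nextField x)).1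
    ⟨x, hx, hx', rfl, rfl⟩
  exact ⟨a, h₁.symm, h₂.symm⟩

/-- Every assumption can be read off at some position of the word. Hence `w.length` rounds of the
search are enough. -/
lemma assumptions_finite_and_card (h : Lists w F A) :
    F.assumptions.Finite ∧ F.assumptions.ncard ≤ w.length := by
  classical
  have hs : F.assumptions ⊆ ((Finset.range w.length).image fun i => fieldWord (w.drop i) :
      Finset (List Bool)) := by
    intro a ha
    obtain ⟨x, hx, hx', hxa⟩ := (h.listed_assumption a).2 ha
    obtain ⟨y, rfl⟩ := hx
    have : x ≠ [] := by rintro rfl; simp at hx'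
    refine Finset.mem_coe.2 (Finset.mem_image.2 ⟨y.length, ?_, by simpa using hxa⟩)
    simpa using List.length_pos_iff.2 this
  refine ⟨(Finset.finite_toSet _).subset hs, (Set.ncard_le_ncard hs (Finset.finite_toSet _)).trans ?_⟩
  rw [Set.ncard_coe_finset]
  exact Finset.card_image_le.trans (by simp)

end Lists

/-! ### Backward search for the assumptions that lead to an attacked one -/

/-- One round of the search for the assumptions that lead to an attacked assumption. -/
def leadStep (F : Framework (List Bool)) (A G : Set (List Bool)) : Set (List Bool) :=
  {s | ∃ a : F.assumptions, a.1 = s ∧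
    (F.Forces A (F.contrary a) ∨ ∃ h ∈ F.assumptions, F.Step s h ∧ h ∈ G)}

lemma leadStep_monotone : Monotone (leadStep F A) := by
  rintro G G' hG s ⟨a, ha, h⟩
  exact ⟨a, ha, h.imp id fun ⟨x, hx, hs, hxG⟩ => ⟨x, hx, hs, hG hxG⟩⟩

/-- By induction on the rounds, the predicate on assumption positions depends only on the sentence
listed there, so positions may be replaced by assumptions. -/
lemma Lists.next_leads_iterate (h : Lists w F A) (t : ℕ) {x : List Symbol} (hx : x <:+ w)
    (hx' : x.head? = some .assumption) :
    ((Fm.next 0 Fm.leads w)^[t] fun _ => False) x ↔ fieldWord x ∈ (leadStep F A)^[t] ∅ := by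
  induction t generalizing x with
  | zero => simp
  | succ t ih =>
    rw [iterate_succ_apply', iterate_succ_apply', Fm.next_leads]
    obtain ⟨a, ha, hc⟩ := h.of_suffix hx hx'
    rw [h.listedForces, h.head, hc, ha]
    have e : ∀ s : List Bool, (∃ z, z <:+ w ∧ z.head? = some .assumption ∧ fieldWord z = s ∧
        ((Fm.next 0 Fm.leads w)^[t] fun _ => False) z) ↔
        s ∈ F.assumptions ∧ s ∈ (leadStep F A)^[t] ∅ := by
      intro s
      constructor
      · rintro ⟨z, hz, hz', rfl, hQ⟩
        obtain ⟨a', ha', -⟩ := h.of_suffix hz hz'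
        exact ⟨ha' ▸ a'.2, (ih hz hz').1 hQ⟩
      · rintro ⟨hs, hG⟩
        obtain ⟨z, hz, hz', rfl⟩ := (h.listed_assumption s).2 hs
        exact ⟨z, hz, hz', rfl, (ih hz hz').2 hG⟩
    simp only [e, leadStep, Set.mem_ofPred_eq, Lists.step_iff]
    constructor
    · rintro ⟨-, h'⟩
      refine ⟨a, rfl, h'.imp id ?_⟩
      rintro ⟨x, b, hr, rfl, hx, hG⟩
      exact ⟨x, hx, hr, hG⟩
    · rintro ⟨a', e, h'⟩
      obtain rfl := Subtype.ext e
      exact ⟨hx', h'.imp id fun ⟨x, hx, hr, hG⟩ => ⟨x, _, hr, rfl, hx, hG⟩⟩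

/-- Membership after `n` rounds yields a path by induction on `n`. Conversely, a path is followed
backwards from its attacked end, and the fixed-point equation absorbs the extra round needed for
each step. -/
lemma mem_fixedPoint_iff (hF : F.Bipolar) {n : ℕ}
    (hG : leadStep F A ((leadStep F A)^[n] ∅) = (leadStep F A)^[n] ∅) (a : F.assumptions) :
    a.1 ∈ (leadStep F A)^[n] ∅ ↔
      ∃ b : F.assumptions, ReflTransGen F.Step a b ∧ F.Forces A (F.contrary b) := by
  constructor
  · intro h
    clear hG
    induction n generalizing a with
    | zero => simp at h
    | succ n ih =>
      rw [iterate_succ_apply'] at h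
      obtain ⟨a', e, h' | ⟨x, hx, hs, hxG⟩⟩ := h
      · obtain rfl := Subtype.ext e
        exact ⟨a', .refl, h'⟩
      · obtain ⟨b, hb, hc⟩ := ih ⟨x, hx⟩ hxG
        exact ⟨b, .head hs hb, hc⟩
  · rintro ⟨b, hab, hc⟩
    obtain ⟨a, ha⟩ := a
    change ReflTransGen F.Step a b at hab
    change a ∈ _
    induction hab using ReflTransGen.head_induction_on with
    | refl =>
      rw [← hG]
      exact ⟨b, rfl, .inl hc⟩
    | @head x y hs hyb ih =>
      -- The vertex `y` is the end `b` of the path or the body of the next rule.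
      have hy : y ∈ F.assumptions := by
        rcases hyb.cases_head with rfl | ⟨z, ⟨r, hr, hb, -⟩, -⟩
        · exact b.2
        · obtain ⟨⟨c, hc, hb'⟩, -⟩ := hF r hr
          rw [hb, List.cons.injEq] at hb'
          rw [hb'.1]
          exact hc
      rw [← hG]
      exact ⟨⟨x, ha⟩, rfl, .inr ⟨y, hy, hs, ih hy⟩⟩

/-- After `w.length` rounds the search has reached its fixed point, so `Q` at an assumption position
expresses the reachability condition of `Framework.setStable_iff`. -/
lemma Lists.stable_iff (h : Lists w F A) (hF : F.Bipolar) (hA : A ⊆ F.assumptions) :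
    Stable w ((Fm.next 0 Fm.leads w)^[w.length] fun _ => False) ↔ F.SetStable A := by
  have hG := iterate_stabilizes (leadStep_monotone (F := F) (A := A))
    h.assumptions_finite_and_card.1 (fun G s ⟨a, ha, _⟩ => ha ▸ a.2)
    h.assumptions_finite_and_card.2
  rw [Framework.setStable_iff hF hA, Stable, h.always_head, h.always_assumption]
  simp only [h.listed_member, h.listed_assumption, h.listedForces]
  refine and_congr ?_ (and_congr ?_ ?_)
  · simp only [Lists.step_iff]
    exact ⟨fun h b hb x hx hr => h x b hr hb hx, fun h x b hr hb hx => h b hb x hx hr⟩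
  · rfl
  · constructor
    · intro h' a ha haA
      obtain ⟨x, hx, hx', rfl⟩ := (h.listed_assumption a).2 ha
      by_contra hn
      refine h' ⟨x, hx, hx', not_or_intro haA fun hQ => hn ?_⟩
      exact (mem_fixedPoint_iff hF hG ⟨_, ha⟩).1 ((h.next_leads_iterate _ hx hx').1 hQ)
    · rintro h' ⟨x, hx, hx', hn⟩
      rw [not_or] at hn
      obtain ⟨a, ha, -⟩ := h.of_suffix hx hx'
      refine hn.2 ((h.next_leads_iterate _ hx hx').2 ?_)
      rw [ha] at hn ⊢
      exact (mem_fixedPoint_iff hF hG a).2 (h' a a.2 hn.1)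

end Lists

end ABA

theorem mainTheorem7 : ABA.InP ABA.setStableVER := by
  refine ABA.Fm.inP_of_fm (n := (0 : Fin 6)) (φ := ABA.Fm.leads)
    (ψ := .and .wellFormed (.and .valid .stable)) ?_ ?_ ?_ ?_ fun w => ?_
  · simp [ABA.Fm.leads, ABA.Fm.WF, ABA.Fm.or, ABA.Fm.exMark, ABA.Fm.forces, ABA.Fm.listed,
      ABA.Fm.bv]
  · decide
  · simp [ABA.Fm.wellFormed, ABA.Fm.valid, ABA.Fm.stable, ABA.Fm.WF, ABA.Fm.or, ABA.Fm.imp,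
      ABA.Fm.exMark, ABA.Fm.allMark, ABA.Fm.forces, ABA.Fm.listed, ABA.Fm.bv]
  · decide
  · have e : ∀ Q, ABA.Fm.next 0 (.and .wellFormed (.and .valid .stable)) w Q w ↔
        ABA.WellFormed w ∧ ABA.Valid w ∧ ABA.Stable w Q := fun Q =>
      and_congr (ABA.Fm.sat_wellFormed rfl) (and_congr ABA.Fm.sat_valid ABA.Fm.sat_stable)
    rw [e]
    constructor
    · rintro ⟨F, A, hA, hF, hw, hs⟩
      obtain ⟨h, hl⟩ := hw.wellFormed_and_lists hF
      exact ⟨h, hl.valid hF hA, (hl.stable_iff hF hA).2 hs⟩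
    -- `Lists.stable_iff` applies to whatever bipolar framework and set of assumptions the word
    -- encodes, in particular to those read off from it.
    · rintro ⟨h, hv, hs⟩
      obtain ⟨F, A, hA, hF, hw⟩ := ABA.exists_encodes h hv
      exact ⟨F, A, hA, hF, hw, ((hw.wellFormed_and_lists hF).2.stable_iff hF hA).1 hs⟩
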